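/- For an element $q$ of a field with $q^k\neq 1$ for all $k\ge 1$ (for example a complex number with $|q|<1$, or an indeterminate), put $(q;q)_n=\prod_{k=1}^{n}(1-q^k)$ for $n\ge 0$, and for integers $a,b$ let $${a\brack b}_q=\frac{(q;q)_a}{(q;q)_b(q;q)_{a-b}}\ \text{ if } b\ge 0 \text{ and } a-b\ge 0,\qquad {a\brack b}_q=0\ \text{ otherwise;}$$ the same notation with $q$ replaced by a power of $q$ is used below. For integers $L,M,a,b$ let $\mathcal T(L,M;a,b;q)$ be the refined $q$-trinomial coefficient $$\mathcal T(L,M;a,b;q)=\sum_{\substack{n\ge 0\\ n\equiv L-a\ (\mathrm{mod}\ 2)}} q^{n^2/2}{M\brack n}_q{M+b+\frac{L-a-n}{2}\brack M+b}_q{M-b+\frac{L+a-n}{2}\brack M-b}_q ,$$ where, in base $q^6$, the factor $(q^6)^{n^2/2}$ means $q^{3n^2}$. **Theorem.** Let $\nu$ be a positive integer, let $L,M$ be non-negative integers, and for $n_1,\dots,n_\nu\ge 0$ write $N_k=n_k+n_{k+1}+\cdots+n_\nu$ $(1\le k\le\nu)$. Then $$\sum_{\substack{m,n_1,\dots,n_\nu\ge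 0\\ L+m\equiv N_1+\cdots+N_\nu\ (\mathrm{mod}\ 2)}} q^{m^2+3(N_1^2+\cdots+N_\nu^2)}{L+M-N_1\brack L}_{q^6}{3n_\nu\brack m}_{q^2}{2n_\nu+\frac{L-m-N_1-\cdots-N_\nu}{2}\brack 2n_\nu}_{q^6}\prod_{j=1}^{\nu-1}{L-\sum_{l=1}^{j}N_l+n_j\brack n_j}_{q^6}$$ $$=\sum_{j=-\infty}^{\infty}q^{3(\nu+1)j^2+2j}\,\mathcal T\bigl(L,M;(\nu+1)j,j;q^6\bigr),$$ where both sums have only finitely many nonzero terms. -/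

import Mathlib

open Finset

/-- The `q`-Pochhammer symbol `(a; q)_n = (1 - a) (1 - a q) ⋯ (1 - a q ^ (n - 1))`. -/
def qPoch {K : Type*} [Field K] (a q : K) (n : ℕ) : K :=
  ∏ k ∈ range n, (1 - a * q ^ k)

/-- The `q`-binomial coefficient with integer entries: the quotient
`(q; q)_a / ((q; q)_b (q; q)_(a - b))` if `b ≥ 0` and `a - b ≥ 0`, and `0` otherwise. -/
def qBinom {K : Type*} [Field K] (q : K) (a b : ℤ) : K :=
  if 0 ≤ b ∧ 0 ≤ a - b then
    qPoch q q a.toNat / (qPoch q q b.toNat * qPoch q q (a - b).toNat)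
  else 0

/-- Warnaar's refined `q`-trinomial coefficient `𝒯(L, M; a, b; s ^ 2)`.
Its definition involves half-integral powers of the base, so that it takes a square root `s` of the
base as its argument: the factor (base) ^ (n ^ 2 / 2) is `s ^ (n ^ 2)`.
The sum is over all `n ≥ 0` with `L - a ≡ n` modulo 2; the terms with `n > M` vanish because of the
factor `qBinom (s ^ 2) M n`. -/
def refinedTrinomial {K : Type*} [Field K] (s : K) (L M a b : ℤ) : K :=
  ∑ n ∈ range (M.toNat + 1),
    if L - a ≡ (n : ℤ) [ZMOD 2] then
      s ^ (n ^ 2) * qBinom (s ^ 2) M n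
        * qBinom (s ^ 2) (M + b + (L - a - n) / 2) (M + b)
        * qBinom (s ^ 2) (M - b + (L + a - n) / 2) (M - b)
    else 0

/-- The entry `n_k`, for `1 ≤ k ≤ ν`, of a tuple `(n_1, …, n_ν)`. -/
def entry {ν : ℕ} (n : Fin ν → ℕ) (k : ℕ) : ℕ :=
  if h : 1 ≤ k ∧ k ≤ ν then n ⟨k - 1, by omega⟩ else 0

/-- `N_k = n_k + n_(k+1) + ⋯ + n_ν`. -/
def tailSum {ν : ℕ} (n : Fin ν → ℕ) (k : ℕ) : ℕ :=
  ∑ i ∈ Icc k ν, entry n i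

/-- The term of the multiple sum that belongs to `(m, n_1, …, n_ν)`; it is `0` unless
`L + m ≡ N_1 + ⋯ + N_ν` modulo 2. -/
def hierarchyTerm {K : Type*} [Field K] (q : K) {ν : ℕ} (L M : ℕ) (m : ℕ) (n : Fin ν → ℕ) : K :=
  if L + m ≡ ∑ k ∈ Icc 1 ν, tailSum n k [MOD 2] then
    q ^ (m ^ 2 + 3 * ∑ k ∈ Icc 1 ν, tailSum n k ^ 2)
      * qBinom (q ^ 6) ((L : ℤ) + M - tailSum n 1) L
      * qBinom (q ^ 2) (3 * (entry n ν : ℤ)) m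
      * qBinom (q ^ 6)
          (2 * (entry n ν : ℤ) + ((L : ℤ) - m - ∑ k ∈ Icc 1 ν, (tailSum n k : ℤ)) / 2)
          (2 * (entry n ν : ℤ))
      * ∏ j ∈ Icc 1 (ν - 1),
          qBinom (q ^ 6) ((L : ℤ) - ∑ l ∈ Icc 1 j, (tailSum n l : ℤ) + entry n j) (entry n j)
  else 0

/-- The polynomial extension of the `q`-binomial coefficient `[k + d, k]` to all integers `d`. -/
def gaussH {K : Type*} [Field K] (q : K) (k d : ℤ) : K :=
  if 0 ≤ k then ∏ i ∈ range k.toNat, (1 - q ^ (d + 1 + i)) / (1 - q ^ (i + 1)) else 0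

section GaussH

variable {K : Type*} [Field K] {q : K}

theorem zpow_eq_pow_mul (hq0 : q ≠ 0) (n : ℕ) (k : ℤ) : q ^ k = q ^ n * q ^ (k - n) := by
  rw [← zpow_natCast, ← zpow_add₀ hq0, add_sub_cancel]

theorem gaussH_of_neg (q : K) {k : ℤ} (hk : k < 0) (d : ℤ) : gaussH q k d = 0 := by
  simp [gaussH, hk]

theorem gaussH_natCast (q : K) (k : ℕ) (d : ℤ) :
    gaussH q k d = ∏ i ∈ range k, (1 - q ^ (d + 1 + i)) / (1 - q ^ (i + 1)) := by
  simp [gaussH]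

@[simp] theorem gaussH_zero (q : K) (d : ℤ) : gaussH q 0 d = 1 := by
  simp [gaussH]

theorem gaussH_neg_one {k : ℤ} (hk : 0 < k) : gaussH q k (-1) = 0 := by
  obtain ⟨m, rfl⟩ : ∃ m : ℕ, k = ((m + 1 : ℕ) : ℤ) := ⟨(k - 1).toNat, by omega⟩
  rw [gaussH_natCast, prod_range_succ']
  simp

theorem one_sub_pow_ne_zero (hq : ∀ k : ℕ, 0 < k → q ^ k ≠ 1) (i : ℕ) : 1 - q ^ (i + 1) ≠ 0 :=
  sub_ne_zero.2 (hq (i + 1) i.succ_pos).symm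

theorem gaussH_succ_mul (hq : ∀ k : ℕ, 0 < k → q ^ k ≠ 1) (m : ℕ) (d : ℤ) :
    gaussH q ((m + 1 : ℕ) : ℤ) d * (1 - q ^ (m + 1)) =
      gaussH q (m : ℤ) d * (1 - q ^ (d + 1 + m)) := by
  have h := one_sub_pow_ne_zero hq m
  rw [gaussH_natCast, gaussH_natCast, prod_range_succ]
  field_simp

theorem gaussH_succ_pred_mul (hq : ∀ k : ℕ, 0 < k → q ^ k ≠ 1) (m : ℕ) (d : ℤ) :
    gaussH q ((m + 1 : ℕ) : ℤ) (d - 1) * (1 - q ^ (m + 1)) =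
      gaussH q (m : ℤ) d * (1 - q ^ d) := by
  rw [gaussH_natCast, gaussH_natCast, prod_div_distrib, prod_div_distrib, prod_range_succ',
    prod_range_succ (fun i : ℕ => 1 - q ^ (i + 1))]
  have h := one_sub_pow_ne_zero hq m
  have h' : ∏ i ∈ range m, (1 - q ^ (i + 1)) ≠ 0 :=
    prod_ne_zero_iff.2 fun i _ => one_sub_pow_ne_zero hq i
  have e : ∏ i ∈ range m, (1 - q ^ (d - 1 + 1 + ((i + 1 : ℕ) : ℤ))) =
      ∏ i ∈ range m, (1 - q ^ (d + 1 + (i : ℤ))) :=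
    prod_congr rfl fun i _ => by congr 2; push_cast; ring
  have e' : d - 1 + 1 + ((0 : ℕ) : ℤ) = d := by simp
  rw [e, e']
  field_simp

theorem gaussH_sub_pow_mul (hq0 : q ≠ 0) (hq : ∀ k : ℕ, 0 < k → q ^ k ≠ 1) (k d : ℤ) :
    gaussH q k d - q ^ k * gaussH q k (d - 1) = gaussH q (k - 1) d := by
  rcases lt_trichotomy k 0 with hk | rfl | hk
  · simp [gaussH_of_neg q hk, gaussH_of_neg q (show k - 1 < 0 by omega)]
  · simp [gaussH_of_neg q (show (-1 : ℤ) < 0 by omega)]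
  · obtain ⟨m, rfl⟩ : ∃ m : ℕ, k = ((m + 1 : ℕ) : ℤ) := ⟨(k - 1).toNat, by omega⟩
    have e : ((m + 1 : ℕ) : ℤ) - 1 = m := by simp
    rw [e]
    apply mul_right_cancel₀ (one_sub_pow_ne_zero hq m)
    have h1 := gaussH_succ_mul hq m d
    have h2 := gaussH_succ_pred_mul hq m d
    have h3 : q ^ (d + 1 + (m : ℤ)) = q ^ d * q ^ (m + 1) := by
      rw [← zpow_natCast, ← zpow_add₀ hq0]; congr 1; push_cast; ring
    rw [h3] at h1
    rw [zpow_natCast]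
    linear_combination h1 - q ^ (m + 1) * h2

theorem gaussH_sub (hq0 : q ≠ 0) (hq : ∀ k : ℕ, 0 < k → q ^ k ≠ 1) (k d : ℤ) :
    gaussH q k d - gaussH q k (d - 1) = q ^ d * gaussH q (k - 1) d := by
  rcases lt_trichotomy k 0 with hk | rfl | hk
  · simp [gaussH_of_neg q hk, gaussH_of_neg q (show k - 1 < 0 by omega)]
  · simp [gaussH_of_neg q (show (-1 : ℤ) < 0 by omega)]
  · obtain ⟨m, rfl⟩ : ∃ m : ℕ, k = ((m + 1 : ℕ) : ℤ) := ⟨(k - 1).toNat, by omega⟩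
    have e : ((m + 1 : ℕ) : ℤ) - 1 = m := by simp
    rw [e]
    apply mul_right_cancel₀ (one_sub_pow_ne_zero hq m)
    have h1 := gaussH_succ_mul hq m d
    have h2 := gaussH_succ_pred_mul hq m d
    have h3 : q ^ (d + 1 + (m : ℤ)) = q ^ d * q ^ (m + 1) := by
      rw [← zpow_natCast, ← zpow_add₀ hq0]; congr 1; push_cast; ring
    rw [h3] at h1
    linear_combination h1 - h2

theorem qPoch_self_ne_zero (hq : ∀ k : ℕ, 0 < k → q ^ k ≠ 1) (n : ℕ) : qPoch q q n ≠ 0 :=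
  prod_ne_zero_iff.2 fun i _ => by
    have := one_sub_pow_ne_zero hq i
    rwa [pow_succ'] at this

theorem qBinom_of_not (q : K) {a b : ℤ} (h : ¬ (0 ≤ b ∧ 0 ≤ a - b)) : qBinom q a b = 0 :=
  if_neg h

theorem qBinom_symm (q : K) (a b : ℤ) : qBinom q a b = qBinom q a (a - b) := by
  unfold qBinom
  by_cases h : 0 ≤ b ∧ 0 ≤ a - b
  · rw [if_pos h, if_pos (by omega), sub_sub_cancel, mul_comm (qPoch q q b.toNat)]
  · rw [if_neg h, if_neg (by omega)]

theorem qBinom_add (hq : ∀ k : ℕ, 0 < k → q ^ k ≠ 1) (k c : ℤ) :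
    qBinom q (k + c) k = if 0 ≤ c then gaussH q k c else 0 := by
  by_cases hk : 0 ≤ k
  swap
  · rw [qBinom_of_not q (by omega), gaussH_of_neg q (by omega), ite_self]
  split_ifs with hc
  swap
  · rw [qBinom_of_not q (by omega)]
  lift k to ℕ using hk
  lift c to ℕ using hc
  rw [qBinom, if_pos (by omega), gaussH_natCast, prod_div_distrib]
  have e1 : ((k : ℤ) + c).toNat = c + k := by omega
  have e2 : ((k : ℤ) + c - k).toNat = c := by omega
  rw [e1, e2, Int.toNat_natCast]
  have h1 : qPoch q q (c + k) =
      qPoch q q c * ∏ i ∈ range k, (1 - q ^ ((c : ℤ) + 1 + i)) := by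
    rw [qPoch, prod_range_add, ← qPoch]
    congr 1
    refine prod_congr rfl fun i _ => ?_
    rw [← pow_succ', ← zpow_natCast]
    congr 2; push_cast; ring
  have h2 : ∏ i ∈ range k, (1 - q ^ (i + 1)) = qPoch q q k :=
    prod_congr rfl fun i _ => by rw [pow_succ']
  rw [h1, h2]
  have := qPoch_self_ne_zero hq c
  have := qPoch_self_ne_zero hq k
  field_simp

theorem qBinom_pascal (hq0 : q ≠ 0) (hq : ∀ k : ℕ, 0 < k → q ^ k ≠ 1) {a b : ℤ}
    (h : a ≠ 0 ∨ b ≠ 0) :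
    qBinom q a b = qBinom q (a - 1) b + q ^ (a - b) * qBinom q (a - 1) (b - 1) := by
  obtain ⟨c, rfl⟩ : ∃ c, a = b + c := ⟨a - b, by ring⟩
  have e1 : b + c - 1 = b + (c - 1) := by ring
  have e2 : qBinom q (b + (c - 1)) (b - 1) = qBinom q ((b - 1) + c) (b - 1) := by congr 1; ring
  rw [e1, e2, qBinom_add hq, qBinom_add hq, qBinom_add hq, add_sub_cancel_left]
  have H := gaussH_sub hq0 hq b c
  rcases lt_trichotomy c 0 with hc | rfl | hc
  · rw [if_neg (by omega), if_neg (by omega), if_neg (by omega)]; simp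
  · rw [if_pos le_rfl, if_neg (by omega), if_pos le_rfl]
    rcases lt_trichotomy b 0 with hb | rfl | hb
    · simp [gaussH_of_neg q hb, gaussH_of_neg q (show b - 1 < 0 by omega)]
    · simp at h
    · rw [zero_sub, gaussH_neg_one hb] at H
      linear_combination H
  · rw [if_pos (by omega), if_pos (by omega), if_pos (by omega)]
    linear_combination H

theorem qBinom_pascal' (hq0 : q ≠ 0) (hq : ∀ k : ℕ, 0 < k → q ^ k ≠ 1) {a b : ℤ}
    (h : a ≠ 0 ∨ b ≠ 0) :
    qBinom q a b = q ^ b * qBinom q (a - 1) b + qBinom q (a - 1) (b - 1) := by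
  have H := qBinom_pascal hq0 hq (a := a) (b := a - b) (by omega)
  rw [← qBinom_symm, sub_sub_cancel] at H
  rw [H, qBinom_symm q (a - 1) b, qBinom_symm q (a - 1) (b - 1)]
  rw [show a - 1 - (b - 1) = a - b by ring, show a - 1 - b = a - b - 1 by ring]
  ring

theorem qBinom_zero_right (hq : ∀ k : ℕ, 0 < k → q ^ k ≠ 1) {a : ℤ} (ha : 0 ≤ a) :
    qBinom q a 0 = 1 := by
  have := qBinom_add hq 0 a
  rw [zero_add, if_pos ha, gaussH_zero] at this
  exact this

theorem qBinom_eq_gaussH (hq : ∀ k : ℕ, 0 < k → q ^ k ≠ 1) {a b : ℤ} (hb : 0 ≤ b) :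
    qBinom q a b = gaussH q (a - b) b := by
  rw [qBinom_symm]
  have := qBinom_add hq (a - b) b
  rwa [sub_add_cancel, if_pos hb] at this

end GaussH

/-- The coefficients `s ^ (n ^ 2) [M, n]` of the product `∏ i < M, (1 + z s ^ (2 i + 1))`. -/
def gaussWeight {K : Type*} [Field K] (s : K) (M n : ℕ) : K :=
  s ^ (n ^ 2) * qBinom (s ^ 2) M n

/-- The product of two `q`-binomial coefficients in the definition of the refined trinomials,
with the second one extended polynomially. -/
def trinomialFactor {K : Type*} [Field K] (q : K) (k l B a : ℤ) : K :=
  if 2 ∣ B then qBinom q (k + B / 2) k * gaussH q l (B / 2 + a) else 0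

/-- The polynomial extension of the refined `q`-trinomial `𝒯(A + a, M; a, b; s ^ 2)`. -/
def polyTrinomial {K : Type*} [Field K] (s : K) (b : ℤ) (M : ℕ) (A a : ℤ) : K :=
  ∑ n ∈ range (M + 1), gaussWeight s M n * trinomialFactor (s ^ 2) (M + b) (M - b) (A - n) a

section Recurrences

variable {K : Type*} [Field K] {q s : K}

theorem gaussWeight_zero_right (hq : ∀ k : ℕ, 0 < k → (s ^ 2) ^ k ≠ 1) (M : ℕ) :
    gaussWeight s M 0 = 1 := by
  simp [gaussWeight, qBinom_zero_right hq (Int.natCast_nonneg M)]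

theorem gaussWeight_of_lt (s : K) {M n : ℕ} (h : M < n) : gaussWeight s M n = 0 := by
  rw [gaussWeight, qBinom_of_not _ (by omega), mul_zero]

theorem gaussWeight_succ_succ (hs : s ≠ 0) (hq : ∀ k : ℕ, 0 < k → (s ^ 2) ^ k ≠ 1) (M n : ℕ) :
    gaussWeight s (M + 1) (n + 1) =
      gaussWeight s M (n + 1) + s ^ (2 * M + 1) * gaussWeight s M n := by
  unfold gaussWeight
  rw [qBinom_pascal (pow_ne_zero 2 hs) hq (a := ((M + 1 : ℕ) : ℤ)) (by omega)]
  rw [show (((M + 1 : ℕ) : ℤ) - 1) = M by simp, show (((n + 1 : ℕ) : ℤ) - 1) = n by simp]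
  rcases le_or_gt n M with h | h
  · obtain ⟨r, rfl⟩ := Nat.exists_eq_add_of_le h
    rw [show (((n + r + 1 : ℕ) : ℤ) - ((n + 1 : ℕ) : ℤ)) = (r : ℕ) by push_cast; ring,
      zpow_natCast]
    ring
  · rw [qBinom_of_not (s ^ 2) (a := M) (b := n) (by omega)]
    ring

theorem gaussWeight_succ_succ' (hs : s ≠ 0) (hq : ∀ k : ℕ, 0 < k → (s ^ 2) ^ k ≠ 1) (M n : ℕ) :
    gaussWeight s (M + 1) (n + 1) =
      (s ^ 2) ^ (n + 1) * gaussWeight s M (n + 1) + s ^ (2 * n + 1) * gaussWeight s M n := by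
  unfold gaussWeight
  rw [qBinom_pascal' (pow_ne_zero 2 hs) hq (a := ((M + 1 : ℕ) : ℤ)) (by omega)]
  rw [show (((M + 1 : ℕ) : ℤ) - 1) = M by simp, show (((n + 1 : ℕ) : ℤ) - 1) = n by simp,
    zpow_natCast]
  ring

theorem trinomialFactor_rec (hq0 : q ≠ 0) (hq : ∀ k : ℕ, 0 < k → q ^ k ≠ 1) {k : ℤ}
    (hk : 0 < k) (l B a : ℤ) :
    trinomialFactor q k l B a - q ^ k * trinomialFactor q k l (B - 2) (a + 1)
      - q ^ l * trinomialFactor q k l B (a - 1) + q ^ (k + l) * trinomialFactor q k l (B - 2) a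
      = trinomialFactor q (k - 1) (l - 1) B a := by
  unfold trinomialFactor
  by_cases h : 2 ∣ B
  swap
  · rw [if_neg h, if_neg (by omega), if_neg (by omega), if_neg (by omega), if_neg h]; simp
  obtain ⟨c, rfl⟩ := h
  rw [if_pos (by omega), if_pos (by omega), if_pos (by omega), if_pos (by omega),
    if_pos (by omega)]
  rw [show 2 * c / 2 = c by omega, show (2 * c - 2) / 2 = c - 1 by omega]
  have h1 := qBinom_pascal' hq0 hq (a := k + c) (b := k) (by omega)
  have h2 := gaussH_sub_pow_mul hq0 hq l (c + a)
  rw [show k + (c - 1) = k + c - 1 by ring, show k - 1 + c = k + c - 1 by ring,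
    show c - 1 + (a + 1) = c + a by ring, show c + (a - 1) = c + a - 1 by ring,
    show c - 1 + a = c + a - 1 by ring, ← h2, zpow_add₀ hq0, h1]
  ring

theorem trinomialFactor_rec' (hq0 : q ≠ 0) (hq : ∀ k : ℕ, 0 < k → q ^ k ≠ 1) {k : ℤ}
    (hk : 0 < k) (l B a : ℤ) :
    trinomialFactor q k l B a - trinomialFactor q k l (B - 2) (a + 1)
      - trinomialFactor q k l B (a - 1) + trinomialFactor q k l (B - 2) a
      = q ^ (B + a) * trinomialFactor q (k - 1) (l - 1) B a := by
  unfold trinomialFactor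
  by_cases h : 2 ∣ B
  swap
  · rw [if_neg h, if_neg (by omega), if_neg (by omega), if_neg (by omega), if_neg h]; simp
  obtain ⟨c, rfl⟩ := h
  rw [if_pos (by omega), if_pos (by omega), if_pos (by omega), if_pos (by omega),
    if_pos (by omega)]
  rw [show 2 * c / 2 = c by omega, show (2 * c - 2) / 2 = c - 1 by omega]
  have h1 := qBinom_pascal hq0 hq (a := k + c) (b := k) (by omega)
  have h2 := gaussH_sub hq0 hq l (c + a)
  rw [add_sub_cancel_left] at h1
  rw [show k + (c - 1) = k + c - 1 by ring, show k - 1 + c = k + c - 1 by ring,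
    show c - 1 + (a + 1) = c + a by ring, show c + (a - 1) = c + a - 1 by ring,
    show c - 1 + a = c + a - 1 by ring, show 2 * c + a = c + (c + a) by ring, zpow_add₀ hq0, h1]
  linear_combination (q ^ c * qBinom q (k + c - 1) (k - 1)) * h2

theorem polyTrinomial_of_neg (s : K) (b : ℤ) (M : ℕ) {A : ℤ} (hA : A < 0) (a : ℤ) :
    polyTrinomial s b M A a = 0 := by
  refine sum_eq_zero fun n _ => ?_
  rw [trinomialFactor]
  split_ifs
  · rw [qBinom_of_not _ (by omega)]; simp
  · simp

theorem polyTrinomial_of_lt (s : K) {b : ℤ} {M : ℕ} (h : (M : ℤ) < b) (A a : ℤ) :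
    polyTrinomial s b M A a = 0 := by
  refine sum_eq_zero fun n _ => ?_
  rw [trinomialFactor]
  split_ifs
  · rw [gaussH_of_neg _ (by omega)]; simp
  · simp

theorem polyTrinomial_self (s : K) {b : ℤ} {M : ℕ} (h : (M : ℤ) = b) (A a a' : ℤ) :
    polyTrinomial s b M A a = polyTrinomial s b M A a' := by
  subst h
  simp [polyTrinomial, trinomialFactor]

theorem polyTrinomial_rec (hs : s ≠ 0) (hq : ∀ k : ℕ, 0 < k → (s ^ 2) ^ k ≠ 1) {b : ℤ}
    (hb : 0 ≤ b) (M : ℕ) (A a : ℤ) :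
    polyTrinomial s b (M + 1) A a
      - (s ^ 2) ^ ((M : ℤ) + 1 + b) * polyTrinomial s b (M + 1) (A - 2) (a + 1)
      - (s ^ 2) ^ ((M : ℤ) + 1 - b) * polyTrinomial s b (M + 1) A (a - 1)
      + (s ^ 2) ^ (2 * (M : ℤ) + 2) * polyTrinomial s b (M + 1) (A - 2) a
      = polyTrinomial s b M A a + s ^ (2 * M + 1) * polyTrinomial s b M (A - 1) a := by
  have hq0 := pow_ne_zero 2 hs
  have key : ∀ n : ℕ, gaussWeight s (M + 1) n *
      trinomialFactor (s ^ 2) (M + b) (M - b) (A - n) a =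
      gaussWeight s (M + 1) n * trinomialFactor (s ^ 2) ((M + 1 : ℕ) + b) ((M + 1 : ℕ) - b) (A - n) a
      - (s ^ 2) ^ ((M : ℤ) + 1 + b) * (gaussWeight s (M + 1) n *
        trinomialFactor (s ^ 2) ((M + 1 : ℕ) + b) ((M + 1 : ℕ) - b) (A - 2 - n) (a + 1))
      - (s ^ 2) ^ ((M : ℤ) + 1 - b) * (gaussWeight s (M + 1) n *
        trinomialFactor (s ^ 2) ((M + 1 : ℕ) + b) ((M + 1 : ℕ) - b) (A - n) (a - 1))
      + (s ^ 2) ^ (2 * (M : ℤ) + 2) * (gaussWeight s (M + 1) n *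
        trinomialFactor (s ^ 2) ((M + 1 : ℕ) + b) ((M + 1 : ℕ) - b) (A - 2 - n) a) := by
    intro n
    have h := trinomialFactor_rec hq0 hq (k := (M + 1 : ℕ) + b) (by omega) ((M + 1 : ℕ) - b)
      (A - n) a
    rw [show ((M + 1 : ℕ) : ℤ) + b - 1 = M + b by push_cast; ring,
      show ((M + 1 : ℕ) : ℤ) - b - 1 = M - b by push_cast; ring,
      show A - (n : ℤ) - 2 = A - 2 - n by ring,
      show ((M + 1 : ℕ) : ℤ) + b + ((M + 1 : ℕ) - b) = 2 * M + 2 by push_cast; ring] at h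
    rw [← h]
    push_cast
    ring
  have lhs : ∑ n ∈ range (M + 2), gaussWeight s (M + 1) n *
      trinomialFactor (s ^ 2) (M + b) (M - b) (A - n) a =
      polyTrinomial s b (M + 1) A a
      - (s ^ 2) ^ ((M : ℤ) + 1 + b) * polyTrinomial s b (M + 1) (A - 2) (a + 1)
      - (s ^ 2) ^ ((M : ℤ) + 1 - b) * polyTrinomial s b (M + 1) A (a - 1)
      + (s ^ 2) ^ (2 * (M : ℤ) + 2) * polyTrinomial s b (M + 1) (A - 2) a := by
    simp only [polyTrinomial, mul_sum, ← sum_sub_distrib, ← sum_add_distrib]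
    exact sum_congr rfl fun n _ => key n
  rw [← lhs, sum_range_succ']
  simp only [gaussWeight_succ_succ hs hq, add_mul, sum_add_distrib]
  have h1 : ∑ n ∈ range (M + 1), gaussWeight s M (n + 1) *
      trinomialFactor (s ^ 2) (M + b) (M - b) (A - (n + 1 : ℕ)) a +
      gaussWeight s (M + 1) 0 * trinomialFactor (s ^ 2) (M + b) (M - b) (A - (0 : ℕ)) a =
      polyTrinomial s b M A a := by
    rw [gaussWeight_zero_right hq, ← gaussWeight_zero_right hq M,
      ← sum_range_succ' (fun n => gaussWeight s M n *
        trinomialFactor (s ^ 2) (M + b) (M - b) (A - n) a), sum_range_succ,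
      gaussWeight_of_lt s (Nat.lt_succ_self M), zero_mul, add_zero]
    rfl
  have h2 : ∑ n ∈ range (M + 1), s ^ (2 * M + 1) * gaussWeight s M n *
      trinomialFactor (s ^ 2) (M + b) (M - b) (A - (n + 1 : ℕ)) a =
      s ^ (2 * M + 1) * polyTrinomial s b M (A - 1) a := by
    rw [polyTrinomial, mul_sum]
    refine sum_congr rfl fun n _ => ?_
    rw [show A - 1 - (n : ℤ) = A - (n + 1 : ℕ) by push_cast; ring]
    ring
  rw [← h1, ← h2]
  ring

theorem polyTrinomial_rec' (hs : s ≠ 0) (hq : ∀ k : ℕ, 0 < k → (s ^ 2) ^ k ≠ 1) {b : ℤ}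
    (hb : 0 ≤ b) (M : ℕ) (A a : ℤ) :
    polyTrinomial s b (M + 1) A a - polyTrinomial s b (M + 1) (A - 2) (a + 1)
      - polyTrinomial s b (M + 1) A (a - 1) + polyTrinomial s b (M + 1) (A - 2) a
      = (s ^ 2) ^ (A + a) * polyTrinomial s b M A a
        + s * (s ^ 2) ^ (A + a - 1) * polyTrinomial s b M (A - 1) a := by
  have hq0 := pow_ne_zero 2 hs
  have key : ∀ n : ℕ, gaussWeight s (M + 1) n * ((s ^ 2) ^ (A + a - n) *
      trinomialFactor (s ^ 2) (M + b) (M - b) (A - n) a) =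
      gaussWeight s (M + 1) n * trinomialFactor (s ^ 2) ((M + 1 : ℕ) + b) ((M + 1 : ℕ) - b) (A - n) a
      - (gaussWeight s (M + 1) n *
        trinomialFactor (s ^ 2) ((M + 1 : ℕ) + b) ((M + 1 : ℕ) - b) (A - 2 - n) (a + 1))
      - (gaussWeight s (M + 1) n *
        trinomialFactor (s ^ 2) ((M + 1 : ℕ) + b) ((M + 1 : ℕ) - b) (A - n) (a - 1))
      + (gaussWeight s (M + 1) n *
        trinomialFactor (s ^ 2) ((M + 1 : ℕ) + b) ((M + 1 : ℕ) - b) (A - 2 - n) a) := by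
    intro n
    have h := trinomialFactor_rec' hq0 hq (k := (M + 1 : ℕ) + b) (by omega) ((M + 1 : ℕ) - b)
      (A - n) a
    rw [show ((M + 1 : ℕ) : ℤ) + b - 1 = M + b by push_cast; ring,
      show ((M + 1 : ℕ) : ℤ) - b - 1 = M - b by push_cast; ring,
      show A - (n : ℤ) - 2 = A - 2 - n by ring,
      show A - (n : ℤ) + a = A + a - n by ring] at h
    rw [← h]
    ring
  have lhs : ∑ n ∈ range (M + 2), gaussWeight s (M + 1) n * ((s ^ 2) ^ (A + a - n) *
      trinomialFactor (s ^ 2) (M + b) (M - b) (A - n) a) =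
      polyTrinomial s b (M + 1) A a - polyTrinomial s b (M + 1) (A - 2) (a + 1)
      - polyTrinomial s b (M + 1) A (a - 1) + polyTrinomial s b (M + 1) (A - 2) a := by
    simp only [polyTrinomial, ← sum_sub_distrib, ← sum_add_distrib]
    exact sum_congr rfl fun n _ => key n
  rw [← lhs, sum_range_succ']
  simp only [gaussWeight_succ_succ' hs hq, add_mul, sum_add_distrib]
  have h1 : ∑ n ∈ range (M + 1), (s ^ 2) ^ (n + 1) * gaussWeight s M (n + 1) *
      ((s ^ 2) ^ (A + a - (n + 1 : ℕ)) *
        trinomialFactor (s ^ 2) (M + b) (M - b) (A - (n + 1 : ℕ)) a) +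
      gaussWeight s (M + 1) 0 * ((s ^ 2) ^ (A + a - (0 : ℕ)) *
        trinomialFactor (s ^ 2) (M + b) (M - b) (A - (0 : ℕ)) a) =
      (s ^ 2) ^ (A + a) * polyTrinomial s b M A a := by
    have e : ∀ n : ℕ, (s ^ 2) ^ (A + a) = (s ^ 2) ^ n * (s ^ 2) ^ (A + a - n) := fun n =>
      zpow_eq_pow_mul hq0 _ _
    have e2 : polyTrinomial s b M A a = ∑ n ∈ range (M + 2), gaussWeight s M n *
        trinomialFactor (s ^ 2) (M + b) (M - b) (A - n) a := by
      rw [sum_range_succ, gaussWeight_of_lt s (Nat.lt_succ_self M), zero_mul, add_zero]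
      rfl
    rw [e2, mul_sum, sum_range_succ' _ (M + 1), gaussWeight_zero_right hq, ← gaussWeight_zero_right hq M]
    congr 1
    · refine sum_congr rfl fun n _ => ?_
      rw [e (n + 1)]
      ring
    · rw [e 0]
      ring
  have h2 : ∑ n ∈ range (M + 1), s ^ (2 * n + 1) * gaussWeight s M n *
      ((s ^ 2) ^ (A + a - (n + 1 : ℕ)) *
        trinomialFactor (s ^ 2) (M + b) (M - b) (A - (n + 1 : ℕ)) a) =
      s * (s ^ 2) ^ (A + a - 1) * polyTrinomial s b M (A - 1) a := by
    rw [polyTrinomial, mul_sum]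
    refine sum_congr rfl fun n _ => ?_
    have e : (s ^ 2) ^ (A + a - 1) = (s ^ 2) ^ n * (s ^ 2) ^ (A + a - (n + 1 : ℕ)) := by
      rw [zpow_eq_pow_mul hq0 n]; congr 2; push_cast; ring
    rw [show A - 1 - (n : ℤ) = A - (n + 1 : ℕ) by push_cast; ring, e]
    ring
  rw [← h1, ← h2]
  ring

theorem polyTrinomial_zero_rec (s : K) {b : ℤ} (hb : 0 ≤ b) (A a : ℤ) :
    polyTrinomial s b 0 A a - (s ^ 2) ^ b * polyTrinomial s b 0 (A - 2) (a + 1)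
      - (s ^ 2) ^ (-b) * polyTrinomial s b 0 A (a - 1) + polyTrinomial s b 0 (A - 2) a = 0 := by
  rcases hb.eq_or_lt with rfl | hb
  · rw [polyTrinomial_self s (by simp) A (a - 1) a, polyTrinomial_self s (by simp) (A - 2) (a + 1) a]
    simp
  · simp [polyTrinomial_of_lt s (show ((0 : ℕ) : ℤ) < b by omega)]

theorem polyTrinomial_zero_rec' (s : K) {b : ℤ} (hb : 0 ≤ b) (A a : ℤ) :
    polyTrinomial s b 0 A a - polyTrinomial s b 0 (A - 2) (a + 1)
      - polyTrinomial s b 0 A (a - 1) + polyTrinomial s b 0 (A - 2) a = 0 := by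
  rcases hb.eq_or_lt with rfl | hb
  · rw [polyTrinomial_self s (by simp) A (a - 1) a, polyTrinomial_self s (by simp) (A - 2) (a + 1) a]
    simp
  · simp [polyTrinomial_of_lt s (show ((0 : ℕ) : ℤ) < b by omega)]

/-- The left-hand side of the transformation formula for refined `q`-trinomials. -/
def trinomialTransform (s : K) (b : ℤ) (M : ℕ) (A a : ℤ) : K :=
  ∑ i ∈ range (M + 1),
    s ^ (i ^ 2) * gaussH (s ^ 2) (M - i) (A + a) * polyTrinomial s b i (A - i) a

theorem trinomialTransform_of_neg (s : K) (b : ℤ) (M : ℕ) {A : ℤ} (hA : A < 0) (a : ℤ) :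
    trinomialTransform s b M A a = 0 :=
  sum_eq_zero fun i _ => by rw [polyTrinomial_of_neg s b i (by omega), mul_zero]

theorem trinomialTransform_of_le (s : K) {b : ℤ} {M : ℕ} (h : (M : ℤ) ≤ b) (A a : ℤ) :
    trinomialTransform s b M A a = s ^ (M ^ 2) * polyTrinomial s b M (A - M) a := by
  rw [trinomialTransform, sum_range_succ, sub_self, gaussH_zero, mul_one]
  convert zero_add _
  refine sum_eq_zero fun i hi => ?_
  rw [mem_range] at hi
  rw [polyTrinomial_of_lt s (by omega), mul_zero]

theorem trinomialTransform_rec (hs : s ≠ 0) (hq : ∀ k : ℕ, 0 < k → (s ^ 2) ^ k ≠ 1) {b : ℤ}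
    (hb : 0 ≤ b) (M : ℕ) (A a : ℤ) :
    trinomialTransform s b (M + 1) A a
      - (s ^ 2) ^ ((M : ℤ) + 1 + b) * trinomialTransform s b (M + 1) (A - 2) (a + 1)
      - (s ^ 2) ^ ((M : ℤ) + 1 - b) * trinomialTransform s b (M + 1) A (a - 1)
      + (s ^ 2) ^ (2 * (M : ℤ) + 2) * trinomialTransform s b (M + 1) (A - 2) a
      = trinomialTransform s b M A a + s ^ (2 * M + 1) * trinomialTransform s b M (A - 1) a := by
  have hq0 := pow_ne_zero 2 hs
  set T : ℕ → K := fun i =>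
    s ^ (i ^ 2) * gaussH (s ^ 2) ((M + 1 : ℕ) - i) (A + a) * polyTrinomial s b i (A - i) a
    - (s ^ 2) ^ ((M : ℤ) + 1 + b) * (s ^ (i ^ 2) *
      gaussH (s ^ 2) ((M + 1 : ℕ) - i) (A - 2 + (a + 1)) * polyTrinomial s b i (A - 2 - i) (a + 1))
    - (s ^ 2) ^ ((M : ℤ) + 1 - b) * (s ^ (i ^ 2) *
      gaussH (s ^ 2) ((M + 1 : ℕ) - i) (A + (a - 1)) * polyTrinomial s b i (A - i) (a - 1))
    + (s ^ 2) ^ (2 * (M : ℤ) + 2) * (s ^ (i ^ 2) *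
      gaussH (s ^ 2) ((M + 1 : ℕ) - i) (A - 2 + a) * polyTrinomial s b i (A - 2 - i) a) with hT
  set U : ℕ → K := fun i =>
    s ^ (i ^ 2) * gaussH (s ^ 2) (M - i) (A + a) * polyTrinomial s b i (A - i) a
    - s ^ (i ^ 2) * (s ^ 2) ^ (M + 1 + i) * gaussH (s ^ 2) (M - i) (A - 1 + a) *
      polyTrinomial s b i (A - 2 - i) a with hU
  set W : ℕ → K := fun i =>
    s ^ (i ^ 2) * gaussH (s ^ 2) (M - i) (A - 1 + a) *
      (s ^ (2 * M + 1) * polyTrinomial s b i (A - 1 - i) a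
        + (s ^ 2) ^ (M + 1 + i) * polyTrinomial s b i (A - 2 - i) a) with hW
  have e1 : A - 2 + (a + 1) = A + a - 1 := by ring
  have e2 : A + (a - 1) = A + a - 1 := by ring
  have e3 : A - 2 + a = A + a - 1 - 1 := by ring
  have e4 : A - 1 + a = A + a - 1 := by ring
  have key0 : T 0 = U 0 := by
    have r := polyTrinomial_zero_rec s hb A a
    have h1 := gaussH_sub_pow_mul hq0 hq ((M : ℤ) + 1) (A + a)
    have h2 := gaussH_sub_pow_mul hq0 hq ((M : ℤ) + 1) (A + a - 1)
    have z1 := zpow_add₀ hq0 ((M : ℤ) + 1) b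
    have z2 := zpow_add₀ hq0 ((M : ℤ) + 1) (-b)
    have z3 := zpow_add₀ hq0 ((M : ℤ) + 1) ((M : ℤ) + 1)
    rw [add_sub_cancel_right] at h1 h2
    rw [← sub_eq_add_neg] at z2
    rw [show (M : ℤ) + 1 + (M + 1) = 2 * M + 2 by ring] at z3
    have z4 : (s ^ 2) ^ (M + 1) = (s ^ 2) ^ ((M : ℤ) + 1) := by rw [← zpow_natCast]; simp
    simp only [hT, hU, e1, e2, e3, e4]
    push_cast
    simp only [sub_zero, add_zero, z4, z1, z2, z3]
    rw [← h1, ← h2]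
    linear_combination (s ^ 0 ^ 2 * (s ^ 2) ^ ((M : ℤ) + 1) *
      gaussH (s ^ 2) ((M : ℤ) + 1) (A + a - 1)) * r
  have keyS : ∀ i ∈ range (M + 1), T (i + 1) = U (i + 1) + W i := by
    intro i hi
    obtain ⟨r, rfl⟩ := Nat.exists_eq_add_of_le (Nat.lt_succ_iff.1 (mem_range.1 hi))
    have R := polyTrinomial_rec hs hq hb i (A - (i + 1 : ℕ)) a
    have h1 := gaussH_sub_pow_mul hq0 hq (r : ℤ) (A + a)
    have h2 := gaussH_sub_pow_mul hq0 hq (r : ℤ) (A + a - 1)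
    have z1 := zpow_add₀ hq0 (r : ℤ) ((i : ℤ) + 1 + b)
    have z2 := zpow_add₀ hq0 (r : ℤ) ((i : ℤ) + 1 - b)
    have z3 := zpow_natCast (s ^ 2) (2 * (i + r) + 2)
    have z4 := zpow_natCast (s ^ 2) (2 * i + 2)
    push_cast at z3 z4
    rw [zpow_natCast] at h1 h2 z1 z2
    rw [z4] at R
    rw [show A - ((i + 1 : ℕ) : ℤ) - 2 = A - 2 - (i + 1 : ℕ) by ring,
      show A - ((i + 1 : ℕ) : ℤ) - 1 = A - 2 - i by push_cast; ring] at R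
    have f1 : ((i + r + 1 : ℕ) : ℤ) - (i + 1 : ℕ) = r := by push_cast; ring
    have f2 : ((i + r : ℕ) : ℤ) - (i + 1 : ℕ) = r - 1 := by push_cast; ring
    have f3 : ((i + r : ℕ) : ℤ) - i = r := by push_cast; ring
    have f4 : ((i + r : ℕ) : ℤ) + 1 + b = r + (i + 1 + b) := by push_cast; ring
    have f5 : ((i + r : ℕ) : ℤ) + 1 - b = r + (i + 1 - b) := by push_cast; ring
    have f6 : 2 * ((i + r : ℕ) : ℤ) + 2 = 2 * (i + r) + 2 := by push_cast; ring
    have f7 : A - 1 - (i : ℤ) = A - (i + 1 : ℕ) := by push_cast; ring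
    simp only [hT, hU, hW, e1, e2, e3, e4, f1, f2, f3, f4, f5, f6, f7, z1, z2, z3]
    rw [← h1, ← h2]
    linear_combination (s ^ (i + 1) ^ 2 * (s ^ 2) ^ r * gaussH (s ^ 2) (r : ℤ) (A + a - 1)) * R
  have lhs : trinomialTransform s b (M + 1) A a
      - (s ^ 2) ^ ((M : ℤ) + 1 + b) * trinomialTransform s b (M + 1) (A - 2) (a + 1)
      - (s ^ 2) ^ ((M : ℤ) + 1 - b) * trinomialTransform s b (M + 1) A (a - 1)
      + (s ^ 2) ^ (2 * (M : ℤ) + 2) * trinomialTransform s b (M + 1) (A - 2) a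
      = ∑ i ∈ range (M + 2), T i := by
    simp only [trinomialTransform, mul_sum, ← sum_sub_distrib, ← sum_add_distrib, hT]
  have hU0 : U (M + 1) = 0 := by
    simp only [hU]
    rw [gaussH_of_neg _ (by push_cast; omega), gaussH_of_neg _ (by push_cast; omega)]
    simp
  rw [lhs, sum_range_succ', sum_congr rfl keyS, sum_add_distrib, key0, add_right_comm,
    ← sum_range_succ', sum_range_succ, hU0, add_zero, ← sum_add_distrib]
  simp only [trinomialTransform, mul_sum, ← sum_add_distrib, hU, hW]
  refine sum_congr rfl fun i _ => ?_
  ring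

theorem trinomialTransform_rec' (hs : s ≠ 0) (hq : ∀ k : ℕ, 0 < k → (s ^ 2) ^ k ≠ 1) {b : ℤ}
    (hb : 0 ≤ b) (M : ℕ) (A a : ℤ) :
    trinomialTransform s b (M + 1) A a - trinomialTransform s b (M + 1) (A - 2) (a + 1)
      - trinomialTransform s b (M + 1) A (a - 1) + trinomialTransform s b (M + 1) (A - 2) a
      = (s ^ 2) ^ (A + a) * trinomialTransform s b M A a
        + s * (s ^ 2) ^ (A + a - 1) * trinomialTransform s b M (A - 1) a := by
  have hq0 := pow_ne_zero 2 hs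
  set T : ℕ → K := fun i =>
    s ^ (i ^ 2) * gaussH (s ^ 2) ((M + 1 : ℕ) - i) (A + a) * polyTrinomial s b i (A - i) a
    - (s ^ (i ^ 2) *
      gaussH (s ^ 2) ((M + 1 : ℕ) - i) (A - 2 + (a + 1)) * polyTrinomial s b i (A - 2 - i) (a + 1))
    - (s ^ (i ^ 2) *
      gaussH (s ^ 2) ((M + 1 : ℕ) - i) (A + (a - 1)) * polyTrinomial s b i (A - i) (a - 1))
    + (s ^ (i ^ 2) *
      gaussH (s ^ 2) ((M + 1 : ℕ) - i) (A - 2 + a) * polyTrinomial s b i (A - 2 - i) a) with hT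
  set U : ℕ → K := fun i =>
    s ^ (i ^ 2) * (s ^ 2) ^ (A + a) * gaussH (s ^ 2) (M - i) (A + a) *
      polyTrinomial s b i (A - i) a
    - s ^ (i ^ 2) * (s ^ 2) ^ (A + a - 1) * gaussH (s ^ 2) (M - i) (A - 1 + a) *
      polyTrinomial s b i (A - 2 - i) a with hU
  set W : ℕ → K := fun i =>
    s ^ (i ^ 2) * (s ^ 2) ^ (A + a - 1) * gaussH (s ^ 2) (M - i) (A - 1 + a) *
      (s * polyTrinomial s b i (A - 1 - i) a + polyTrinomial s b i (A - 2 - i) a) with hW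
  have e1 : A - 2 + (a + 1) = A + a - 1 := by ring
  have e2 : A + (a - 1) = A + a - 1 := by ring
  have e3 : A - 2 + a = A + a - 1 - 1 := by ring
  have e4 : A - 1 + a = A + a - 1 := by ring
  have key0 : T 0 = U 0 := by
    have r := polyTrinomial_zero_rec' s hb A a
    have h1 := gaussH_sub hq0 hq ((M : ℤ) + 1) (A + a)
    have h2 := gaussH_sub hq0 hq ((M : ℤ) + 1) (A + a - 1)
    rw [add_sub_cancel_right] at h1 h2
    simp only [hT, hU, e1, e2, e3, e4]
    push_cast
    simp only [sub_zero, pow_zero, one_mul]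
    rw [← h1, ← h2]
    linear_combination gaussH (s ^ 2) ((M : ℤ) + 1) (A + a - 1) * r
  have keyS : ∀ i ∈ range (M + 1), T (i + 1) = U (i + 1) + W i := by
    intro i hi
    obtain ⟨r, rfl⟩ := Nat.exists_eq_add_of_le (Nat.lt_succ_iff.1 (mem_range.1 hi))
    have R := polyTrinomial_rec' hs hq hb i (A - (i + 1 : ℕ)) a
    have h1 := gaussH_sub hq0 hq (r : ℤ) (A + a)
    have h2 := gaussH_sub hq0 hq (r : ℤ) (A + a - 1)
    have z1 := zpow_eq_pow_mul hq0 i (A + a - 1)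
    have z2 := zpow_eq_pow_mul hq0 1 (A + a - 1 - i)
    rw [show A - ((i + 1 : ℕ) : ℤ) - 2 = A - 2 - (i + 1 : ℕ) by ring,
      show A - ((i + 1 : ℕ) : ℤ) - 1 = A - 2 - i by push_cast; ring,
      show A - ((i + 1 : ℕ) : ℤ) + a - 1 = A + a - 1 - i - 1 by push_cast; ring,
      show A - ((i + 1 : ℕ) : ℤ) + a = A + a - 1 - i by push_cast; ring] at R
    have f1 : ((i + r + 1 : ℕ) : ℤ) - (i + 1 : ℕ) = r := by push_cast; ring
    have f2 : ((i + r : ℕ) : ℤ) - (i + 1 : ℕ) = r - 1 := by push_cast; ring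
    have f3 : ((i + r : ℕ) : ℤ) - i = r := by push_cast; ring
    have f7 : A - 1 - (i : ℤ) = A - (i + 1 : ℕ) := by push_cast; ring
    simp only [Nat.cast_one] at z2
    simp only [hT, hU, hW, e1, e2, e3, e4, f1, f2, f3, f7]
    rw [mul_assoc (s ^ (i + 1) ^ 2) _ (gaussH _ _ _), ← h1,
      mul_assoc (s ^ (i + 1) ^ 2) _ (gaussH _ _ _), ← h2, z1, z2]
    rw [z2] at R
    linear_combination (s ^ (i + 1) ^ 2 * gaussH (s ^ 2) (r : ℤ) (A + a - 1)) * R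
  have lhs : trinomialTransform s b (M + 1) A a - trinomialTransform s b (M + 1) (A - 2) (a + 1)
      - trinomialTransform s b (M + 1) A (a - 1) + trinomialTransform s b (M + 1) (A - 2) a
      = ∑ i ∈ range (M + 2), T i := by
    simp only [trinomialTransform, ← sum_sub_distrib, ← sum_add_distrib, hT]
  have hU0 : U (M + 1) = 0 := by
    simp only [hU]
    rw [gaussH_of_neg _ (by push_cast; omega), gaussH_of_neg _ (by push_cast; omega)]
    simp
  rw [lhs, sum_range_succ', sum_congr rfl keyS, sum_add_distrib, key0, add_right_comm,
    ← sum_range_succ', sum_range_succ, hU0, add_zero, ← sum_add_distrib]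
  simp only [trinomialTransform, mul_sum, ← sum_add_distrib, hU, hW]
  refine sum_congr rfl fun i _ => ?_
  ring

theorem trinomialTransform_eq (hs : s ≠ 0) (hq : ∀ k : ℕ, 0 < k → (s ^ 2) ^ k ≠ 1) (b : ℕ)
    (M : ℕ) (A a : ℤ) :
    trinomialTransform s b M A a = s ^ (b ^ 2) * polyTrinomial s b M (A - b) (a + b) := by
  induction M generalizing A a with
  | zero =>
    rw [trinomialTransform_of_le s (by simp)]
    rcases Nat.eq_zero_or_pos b with rfl | hb
    · simp
    · rw [polyTrinomial_of_lt s (by simpa using hb), polyTrinomial_of_lt s (by simpa using hb)]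
      simp
  | succ M ih =>
    rcases lt_trichotomy (M + 1) b with h | h | h
    · rw [trinomialTransform_of_le s (by omega), polyTrinomial_of_lt s (by omega),
        polyTrinomial_of_lt s (by omega)]
      simp
    · rw [trinomialTransform_of_le s (by omega), h, polyTrinomial_self s (by simp) _ a (a + b)]
    obtain hA | hA := lt_or_ge A 0
    · rw [trinomialTransform_of_neg s _ _ hA, polyTrinomial_of_neg s _ _ (by omega), mul_zero]
    lift A to ℕ using hA
    induction A using Nat.strong_induction_on generalizing a with
    | _ A ihA =>
      have ih2 : ∀ a : ℤ, trinomialTransform s b (M + 1) ((A : ℤ) - 2) a =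
          s ^ (b ^ 2) * polyTrinomial s b (M + 1) ((A : ℤ) - 2 - b) (a + b) := by
        intro a
        obtain hA | hA := lt_or_ge ((A : ℤ) - 2) 0
        · rw [trinomialTransform_of_neg s _ _ hA, polyTrinomial_of_neg s _ _ (by omega), mul_zero]
        · have := ihA (A - 2) (by omega) a
          rwa [Nat.cast_sub (by omega), Nat.cast_ofNat] at this
      have r1 := trinomialTransform_rec hs hq (Int.natCast_nonneg b) M A a
      have r2 := trinomialTransform_rec' hs hq (Int.natCast_nonneg b) M A a
      have r3 := polyTrinomial_rec hs hq (Int.natCast_nonneg b) M (A - b) (a + b)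
      have r4 := polyTrinomial_rec' hs hq (Int.natCast_nonneg b) M (A - b) (a + b)
      rw [ih, ih, ih2, ih2] at r1 r2
      rw [show (A : ℤ) - b - 2 = A - 2 - b by ring, show (A : ℤ) - b - 1 = A - 1 - b by ring,
        show a + b + 1 = a + 1 + b by ring, show a + b - 1 = a - 1 + b by ring] at r3 r4
      rw [show (A : ℤ) - b + (a + b) = A + a by ring] at r4
      have hne : 1 - (s ^ 2) ^ ((M : ℤ) + 1 - b) ≠ 0 := by
        have := hq (M + 1 - b) (by omega)
        rw [← zpow_natCast, Nat.cast_sub (by omega)] at this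
        push_cast at this
        exact sub_ne_zero.2 this.symm
      apply mul_left_cancel₀ hne
      linear_combination r1 - (s ^ 2) ^ ((M : ℤ) + 1 - b) * r2
        - s ^ (b ^ 2) * (r3 - (s ^ 2) ^ ((M : ℤ) + 1 - b) * r4)

end Recurrences

/-- The product `s ^ ((c - d) ^ 2) [A + d, c] [B + c, d]` of the `q`-Pfaff–Saalschütz sum. -/
def saalschuetzTerm {K : Type*} [Field K] (s : K) (A B : ℕ) (c d : ℤ) : K :=
  s ^ ((c - d) ^ 2) * qBinom (s ^ 2) (A + d) c * qBinom (s ^ 2) (B + c) d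

/-- The power series `∑ f c d X ^ (c + d)`. -/
def diagSeries {K : Type*} [Field K] (f : ℤ → ℤ → K) : PowerSeries K :=
  PowerSeries.mk fun N => ∑ p ∈ antidiagonal N, f p.1 p.2

/-- The generating function of the `q`-binomial coefficients `[m + k, m]` in `X ^ 2`. -/
def evenSeries {K : Type*} [Field K] (q : K) (m : ℕ) : PowerSeries K :=
  PowerSeries.mk fun N => if 2 ∣ (N : ℤ) then qBinom q (m + (N : ℤ) / 2) m else 0

/-- The sum on the left-hand side of the identity at the bottom of the hierarchy. -/
def baseSum {K : Type*} [Field K] (q : K) (L : ℤ) (M : ℕ) : K :=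
  ∑ m ∈ range (3 * M + 1), if 2 ∣ L - m then
    q ^ (m ^ 2) * qBinom (q ^ 2) (3 * M) m * qBinom (q ^ 6) (2 * M + (L - m) / 2) (2 * M) else 0

section Base

open PowerSeries

variable {K : Type*} [Field K] {s q : K}

theorem diagSeries_add (f g : ℤ → ℤ → K) :
    diagSeries (fun c d => f c d + g c d) = diagSeries f + diagSeries g := by
  ext N; simp [diagSeries, sum_add_distrib]

theorem diagSeries_const_mul (a : K) (f : ℤ → ℤ → K) :
    diagSeries (fun c d => a * f c d) = C a * diagSeries f := by
  ext N; simp [diagSeries, mul_sum]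

theorem diagSeries_congr {f g : ℤ → ℤ → K} (h : ∀ c d : ℤ, 0 ≤ c → 0 ≤ d → f c d = g c d) :
    diagSeries f = diagSeries g := by
  ext N
  simp only [diagSeries, coeff_mk]
  exact sum_congr rfl fun p _ => h _ _ (by omega) (by omega)

theorem diagSeries_shift_left {f : ℤ → ℤ → K} (h : ∀ c d : ℤ, c < 0 → f c d = 0) :
    diagSeries (fun c d => f (c - 1) d) = X * diagSeries f := by
  ext N
  cases N with
  | zero => simp [diagSeries, h]
  | succ N =>
    rw [coeff_succ_X_mul]
    simp [diagSeries, Finset.Nat.sum_antidiagonal_succ, h]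

theorem diagSeries_shift_right {f : ℤ → ℤ → K} (h : ∀ c d : ℤ, d < 0 → f c d = 0) :
    diagSeries (fun c d => f c (d - 1)) = X * diagSeries f := by
  ext N
  cases N with
  | zero => simp [diagSeries, h]
  | succ N =>
    rw [coeff_succ_X_mul]
    simp [diagSeries, Finset.Nat.sum_antidiagonal_succ', h]

theorem saalschuetzTerm_swap (s : K) (A B : ℕ) (c d : ℤ) :
    saalschuetzTerm s A B c d = saalschuetzTerm s B A d c := by
  unfold saalschuetzTerm
  rw [show (d - c) ^ 2 = (c - d) ^ 2 by ring]
  ring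

theorem saalschuetzTerm_of_neg_left (s : K) (A B : ℕ) {c : ℤ} (hc : c < 0) (d : ℤ) :
    saalschuetzTerm s A B c d = 0 := by
  rw [saalschuetzTerm, qBinom_of_not _ (b := c) (by omega)]; simp

theorem saalschuetzTerm_of_neg_right (s : K) (A B : ℕ) (c : ℤ) {d : ℤ} (hd : d < 0) :
    saalschuetzTerm s A B c d = 0 := by
  rw [saalschuetzTerm_swap, saalschuetzTerm_of_neg_left _ _ _ hd]

theorem saalschuetzTerm_succ (hs : s ≠ 0) (hq : ∀ k : ℕ, 0 < k → (s ^ 2) ^ k ≠ 1) (A B : ℕ)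
    {c d : ℤ} (hc : 0 ≤ c) (hd : 0 ≤ d) :
    saalschuetzTerm s (A + 1) B c d = saalschuetzTerm s A B c d
      + s ^ (2 * A + 1) * saalschuetzTerm s A B (c - 1) d
      + (s ^ 2) ^ (A + B + 1) * saalschuetzTerm s (A + 1) B (c - 1) (d - 1) := by
  have hq0 := pow_ne_zero 2 hs
  unfold saalschuetzTerm
  have h1 := qBinom_pascal hq0 hq (a := (A + 1 : ℕ) + d) (b := c) (by omega)
  rw [show ((A + 1 : ℕ) : ℤ) + d - 1 = A + d by push_cast; ring] at h1
  rw [h1, show ((A + 1 : ℕ) : ℤ) + (d - 1) = A + d by push_cast; ring,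
    show c - 1 - (d - 1) = c - d by ring, show (B : ℤ) + (c - 1) = B + c - 1 by ring]
  rcases hc.eq_or_lt with rfl | hc
  · simp [qBinom_of_not (s ^ 2) (a := A + d) (b := -1) (by omega)]
  have h2 := qBinom_pascal hq0 hq (a := B + c) (b := d) (by omega)
  rw [h2]
  have z1 : s ^ ((c - 1 - d) ^ 2) * s ^ (2 * A + 1) =
      s ^ ((c - d) ^ 2) * (s ^ 2) ^ (((A + 1 : ℕ) : ℤ) + d - c) := by
    rw [← zpow_natCast s (2 * A + 1), ← zpow_natCast s 2, ← zpow_mul, ← zpow_add₀ hs,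
      ← zpow_add₀ hs]
    congr 1; push_cast; ring
  have z2 : (s ^ 2) ^ (A + B + 1) =
      (s ^ 2) ^ (((A + 1 : ℕ) : ℤ) + d - c) * (s ^ 2) ^ ((B : ℤ) + c - d) := by
    rw [← zpow_natCast (s ^ 2) (A + B + 1), ← zpow_add₀ hq0]
    congr 1; push_cast; ring
  rw [z2]
  linear_combination (- qBinom (s ^ 2) (A + d) (c - 1) * qBinom (s ^ 2) (B + c - 1) d) * z1

theorem saalschuetzTerm_zero (hq : ∀ k : ℕ, 0 < k → (s ^ 2) ^ k ≠ 1) {c d : ℤ}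
    (hc : 0 ≤ c) (hd : 0 ≤ d) :
    saalschuetzTerm s 0 0 c d = if c = d then 1 else 0 := by
  unfold saalschuetzTerm
  split_ifs with h
  · subst h
    have : qBinom (s ^ 2) c c = 1 := by
      rw [qBinom_symm, sub_self, qBinom_zero_right hq hc]
    simp [this]
  · rcases lt_or_gt_of_ne h with h | h
    · rw [qBinom_of_not _ (a := ((0 : ℕ) : ℤ) + c) (by push_cast; omega), mul_zero]
    · rw [qBinom_of_not _ (a := ((0 : ℕ) : ℤ) + d) (by push_cast; omega), mul_zero, zero_mul]

/-- The generating function of `saalschuetzTerm`, with weights `x` and `y`. -/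
def saalschuetzSeries (s x y : K) (A B : ℕ) : PowerSeries K :=
  diagSeries fun c d => x ^ c * y ^ d * saalschuetzTerm s A B c d

theorem saalschuetzSeries_swap (s x y : K) (A B : ℕ) :
    saalschuetzSeries s x y A B = saalschuetzSeries s y x B A := by
  ext N
  simp only [saalschuetzSeries, diagSeries, coeff_mk]
  rw [← Finset.Nat.sum_antidiagonal_swap]
  refine sum_congr rfl fun p _ => ?_
  rw [saalschuetzTerm_swap, Prod.fst_swap, Prod.snd_swap, mul_comm (y ^ _)]

theorem saalschuetzSeries_succ (hs : s ≠ 0) (hq : ∀ k : ℕ, 0 < k → (s ^ 2) ^ k ≠ 1) {x y : K}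
    (hx : x ≠ 0) (hy : y ≠ 0) (A B : ℕ) :
    saalschuetzSeries s x y (A + 1) B * (1 - C (x * y * (s ^ 2) ^ (A + B + 1)) * X ^ 2) =
      saalschuetzSeries s x y A B * (1 + C (x * s ^ (2 * A + 1)) * X) := by
  have e1 : diagSeries (fun c d => x ^ (c - 1) * y ^ d * saalschuetzTerm s A B (c - 1) d) =
      X * saalschuetzSeries s x y A B :=
    diagSeries_shift_left (f := fun c d => x ^ c * y ^ d * saalschuetzTerm s A B c d)
      fun c d hc => by rw [saalschuetzTerm_of_neg_left _ _ _ hc, mul_zero]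
  have e2 : diagSeries (fun c d => x ^ (c - 1) * y ^ (d - 1) *
      saalschuetzTerm s (A + 1) B (c - 1) (d - 1)) =
      X * (X * saalschuetzSeries s x y (A + 1) B) := by
    rw [saalschuetzSeries, ← diagSeries_shift_right
      (fun c d hd => by rw [saalschuetzTerm_of_neg_right _ _ _ _ hd, mul_zero])]
    exact diagSeries_shift_left (f := fun c d => x ^ c * y ^ (d - 1) *
        saalschuetzTerm s (A + 1) B c (d - 1))
      fun c d hc => by rw [saalschuetzTerm_of_neg_left _ _ _ hc, mul_zero]
  have e3 : saalschuetzSeries s x y (A + 1) B = saalschuetzSeries s x y A B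
      + (C (x * s ^ (2 * A + 1)) * (X * saalschuetzSeries s x y A B)
      + C (x * y * (s ^ 2) ^ (A + B + 1)) * (X * (X * saalschuetzSeries s x y (A + 1) B))) := by
    rw [← e1, ← e2, ← diagSeries_const_mul, ← diagSeries_const_mul, ← diagSeries_add]
    conv_rhs => rw [saalschuetzSeries, ← diagSeries_add]
    refine diagSeries_congr fun c d hc hd => ?_
    rw [saalschuetzTerm_succ hs hq A B hc hd]
    have hx1 : x ^ c = x * x ^ (c - 1) := by
      have := zpow_eq_pow_mul hx 1 c
      simpa using this
    have hy1 : y ^ d = y * y ^ (d - 1) := by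
      have := zpow_eq_pow_mul hy 1 d
      simpa using this
    rw [hx1, hy1]
    ring
  linear_combination e3

theorem saalschuetzSeries_zero (hq : ∀ k : ℕ, 0 < k → (s ^ 2) ^ k ≠ 1) {x y : K}
    (hx : x ≠ 0) (hy : y ≠ 0) :
    saalschuetzSeries s x y 0 0 * (1 - C (x * y) * X ^ 2) = 1 := by
  have e2 : diagSeries (fun c d => x ^ (c - 1) * y ^ (d - 1) *
      saalschuetzTerm s 0 0 (c - 1) (d - 1)) = X * (X * saalschuetzSeries s x y 0 0) := by
    rw [saalschuetzSeries, ← diagSeries_shift_right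
      (fun c d hd => by rw [saalschuetzTerm_of_neg_right _ _ _ _ hd, mul_zero])]
    exact diagSeries_shift_left (f := fun c d => x ^ c * y ^ (d - 1) *
        saalschuetzTerm s 0 0 c (d - 1))
      fun c d hc => by rw [saalschuetzTerm_of_neg_left _ _ _ hc, mul_zero]
  have e0 : diagSeries (fun c d => if c = 0 ∧ d = 0 then (1 : K) else 0) = 1 := by
    ext N
    rw [coeff_one]
    simp only [diagSeries, coeff_mk]
    cases N with
    | zero => rw [Finset.Nat.antidiagonal_zero, sum_singleton]; simp
    | succ N =>
      rw [if_neg (by omega)]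
      refine sum_eq_zero fun p hp => if_neg ?_
      rw [HasAntidiagonal.mem_antidiagonal] at hp
      omega
  have e3 : saalschuetzSeries s x y 0 0 =
      1 + C (x * y) * (X * (X * saalschuetzSeries s x y 0 0)) := by
    rw [← e2, ← diagSeries_const_mul, ← e0, ← diagSeries_add]
    refine diagSeries_congr fun c d hc hd => ?_
    have hx1 : x ^ c = x * x ^ (c - 1) := by
      have := zpow_eq_pow_mul hx 1 c
      simpa using this
    have hy1 : y ^ d = y * y ^ (d - 1) := by
      have := zpow_eq_pow_mul hy 1 d
      simpa using this
    rw [saalschuetzTerm_zero hq hc hd]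
    rcases hc.eq_or_lt with rfl | hc
    · rw [saalschuetzTerm_of_neg_left _ _ _ (by omega)]
      rcases hd.eq_or_lt with rfl | hd
      · simp
      · rw [if_neg (by omega), if_neg (by omega)]; simp
    rcases hd.eq_or_lt with rfl | hd
    · rw [saalschuetzTerm_of_neg_right _ _ _ _ (by omega), if_neg (by omega), if_neg (by omega)]
      simp
    rw [saalschuetzTerm_zero hq (by omega) (by omega), if_neg (c := c = 0 ∧ d = 0) (by omega),
      hx1, hy1]
    by_cases h : c = d
    · rw [if_pos h, if_pos (by omega)]; ring
    · rw [if_neg h, if_neg (by omega)]; ring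
  linear_combination e3

theorem saalschuetzSeries_mul (hs : s ≠ 0) (hq : ∀ k : ℕ, 0 < k → (s ^ 2) ^ k ≠ 1) {x y : K}
    (hx : x ≠ 0) (hy : y ≠ 0) (A B : ℕ) :
    saalschuetzSeries s x y A B *
        ∏ k ∈ range (A + B + 1), (1 - C (x * y * (s ^ 2) ^ k) * X ^ 2) =
      (∏ i ∈ range A, (1 + C (x * s ^ (2 * i + 1)) * X)) *
        ∏ i ∈ range B, (1 + C (y * s ^ (2 * i + 1)) * X) := by
  induction A with
  | zero =>
    induction B with
    | zero => simpa using saalschuetzSeries_zero hq hx hy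
    | succ B ih =>
      have h := saalschuetzSeries_succ hs hq hy hx B 0
      rw [saalschuetzSeries_swap, saalschuetzSeries_swap s y x B 0, mul_comm y x, add_zero] at h
      rw [zero_add, range_zero, prod_empty, one_mul] at ih ⊢
      rw [prod_range_succ, prod_range_succ (fun i => 1 + C (y * s ^ (2 * i + 1)) * X), ← ih]
      linear_combination (∏ k ∈ range (B + 1), (1 - C (x * y * (s ^ 2) ^ k) * X ^ 2)) * h
  | succ A ih =>
    have h := saalschuetzSeries_succ hs hq hx hy A B
    rw [show A + 1 + B + 1 = (A + B + 1) + 1 by ring, prod_range_succ, prod_range_succ _ A,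
      mul_right_comm (∏ _ ∈ range A, _), ← ih]
    linear_combination (∏ k ∈ range (A + B + 1), (1 - C (x * y * (s ^ 2) ^ k) * X ^ 2)) * h

theorem mk_gaussWeight (hs : s ≠ 0) (hq : ∀ k : ℕ, 0 < k → (s ^ 2) ^ k ≠ 1) (M : ℕ) :
    PowerSeries.mk (gaussWeight s M) = ∏ i ∈ range M, (1 + C (s ^ (2 * i + 1)) * X) := by
  induction M with
  | zero =>
    ext N
    rw [coeff_mk, range_zero, prod_empty, coeff_one]
    cases N with
    | zero => simp [gaussWeight_zero_right hq]
    | succ N => simp [gaussWeight_of_lt]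
  | succ M ih =>
    rw [prod_range_succ, ← ih]
    ext N
    rw [mul_add, mul_one, map_add, mul_left_comm, coeff_C_mul, coeff_mk, coeff_mk]
    cases N with
    | zero => simp [gaussWeight_zero_right hq]
    | succ N => rw [coeff_succ_mul_X, coeff_mk, gaussWeight_succ_succ hs hq]

theorem evenSeries_mul (hq0 : q ≠ 0) (hq : ∀ k : ℕ, 0 < k → q ^ k ≠ 1) (m : ℕ) :
    evenSeries q m * ∏ k ∈ range (m + 1), (1 - C (q ^ k) * X ^ 2) = 1 := by
  induction m with
  | zero =>
    have : evenSeries q 0 = 1 + X ^ 2 * evenSeries q 0 := by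
      ext N
      rw [map_add, coeff_one, coeff_X_pow_mul']
      simp only [evenSeries, coeff_mk]
      by_cases h2 : 2 ∣ (N : ℤ)
      · rw [if_pos h2, Nat.cast_zero, qBinom_zero_right hq (by omega)]
        rcases Nat.eq_zero_or_pos N with rfl | hN
        · simp
        · rw [if_neg (by omega), if_pos (by omega), if_pos (by omega),
            qBinom_zero_right hq (by omega), zero_add]
      · rw [if_neg h2, if_neg (by omega), zero_add]
        split_ifs
        · omega
        · rfl
        · rfl
    simp only [zero_add, range_one, prod_singleton, pow_zero, map_one, one_mul]
    linear_combination this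
  | succ m ih =>
    have : evenSeries q (m + 1) = evenSeries q m + C (q ^ (m + 1)) * (X ^ 2 * evenSeries q (m + 1)) := by
      ext N
      rw [map_add, coeff_C_mul, coeff_X_pow_mul']
      simp only [evenSeries, coeff_mk]
      by_cases h2 : 2 ∣ (N : ℤ)
      · rw [if_pos h2, if_pos h2, qBinom_pascal' hq0 hq (by omega), zpow_natCast]
        rw [show ((m + 1 : ℕ) : ℤ) + N / 2 - 1 = m + N / 2 by push_cast; ring,
          show ((m + 1 : ℕ) : ℤ) - 1 = m by simp]
        split_ifs with h h'
        · rw [show ((m + 1 : ℕ) : ℤ) + ((N - 2 : ℕ) : ℤ) / 2 = m + N / 2 by omega]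
          ring
        · omega
        · rw [qBinom_of_not q (a := m + (N : ℤ) / 2) (b := (m + 1 : ℕ)) (by omega)]
          ring
      · rw [if_neg h2, if_neg h2]
        split_ifs
        · omega
        · simp
        · simp
    rw [prod_range_succ]
    linear_combination ih + (∏ k ∈ range (m + 1), (1 - C (q ^ k) * X ^ 2)) * this

theorem prod_range_three_mul {R : Type*} [CommMonoid R] (f : ℕ → R) (M : ℕ) :
    ∏ i ∈ range (3 * M), f i =
      (∏ i ∈ range M, f (3 * i + 1)) * ((∏ i ∈ range M, f (3 * i)) * ∏ i ∈ range M, f (3 * i + 2)) := by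
  rw [← prod_mul_distrib, ← prod_mul_distrib]
  induction M with
  | zero => simp
  | succ M ih =>
    rw [mul_add, mul_one, prod_range_succ, prod_range_succ, prod_range_succ, ih, prod_range_succ,
      mul_left_comm (f (3 * M + 1)), ← mul_assoc (f (3 * M)), mul_assoc _ (f (3 * M)),
      mul_assoc _ (f (3 * M) * f (3 * M + 1))]

theorem gaussWeight_mul_evenSeries (hq0 : q ≠ 0) (hq : ∀ k : ℕ, 0 < k → q ^ k ≠ 1) (M : ℕ) :
    PowerSeries.mk (gaussWeight q (3 * M)) * evenSeries ((q ^ 3) ^ 2) (2 * M) =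
      PowerSeries.mk (gaussWeight (q ^ 3) M) *
        saalschuetzSeries (q ^ 3) ((q ^ 2)⁻¹) (q ^ 2) M M := by
  have hpow : ∀ n : ℕ, 0 < n → ∀ k : ℕ, 0 < k → (q ^ n) ^ k ≠ 1 := fun n hn k hk => by
    rw [← pow_mul]; exact hq _ (Nat.mul_pos hn hk)
  have h6 : ∀ k : ℕ, 0 < k → ((q ^ 3) ^ 2) ^ k ≠ 1 := by
    rw [← pow_mul]; exact hpow 6 (by norm_num)
  have hs : q ^ 3 ≠ 0 := pow_ne_zero 3 hq0
  have h2 : q ^ 2 ≠ 0 := pow_ne_zero 2 hq0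
  have hE := evenSeries_mul (pow_ne_zero 2 hs) h6 (2 * M)
  have hS := saalschuetzSeries_mul hs h6 (inv_ne_zero h2) h2 M M
  rw [inv_mul_cancel₀ h2] at hS
  simp only [one_mul] at hS
  rw [← two_mul] at hS
  have hU : PowerSeries.mk (gaussWeight q (3 * M)) = PowerSeries.mk (gaussWeight (q ^ 3) M) *
      ((∏ i ∈ range M, (1 + C ((q ^ 2)⁻¹ * (q ^ 3) ^ (2 * i + 1)) * X)) *
        ∏ i ∈ range M, (1 + C (q ^ 2 * (q ^ 3) ^ (2 * i + 1)) * X)) := by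
    rw [mk_gaussWeight hq0 (hpow 2 (by norm_num)), mk_gaussWeight hs h6, prod_range_three_mul]
    congr 1
    · refine prod_congr rfl fun i _ => ?_
      congr 3; ring
    congr 1
    · refine prod_congr rfl fun i _ => ?_
      congr 3; field_simp; ring
    · refine prod_congr rfl fun i _ => ?_
      congr 3; ring
  rw [hU, ← hS]
  linear_combination (PowerSeries.mk (gaussWeight (q ^ 3) M) *
    saalschuetzSeries (q ^ 3) ((q ^ 2)⁻¹) (q ^ 2) M M) * hE

theorem baseSum_eq_coeff (q : K) (L M : ℕ) :
    baseSum q L M = coeff L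
      (PowerSeries.mk (gaussWeight q (3 * M)) * evenSeries ((q ^ 3) ^ 2) (2 * M)) := by
  rw [coeff_mul, Finset.Nat.sum_antidiagonal_eq_sum_range_succ_mk]
  simp only [coeff_mk, evenSeries]
  have h : ∀ m ∈ range (L + 1), gaussWeight q (3 * M) m *
      (if 2 ∣ ((L - m : ℕ) : ℤ) then
        qBinom ((q ^ 3) ^ 2) ((2 * M : ℕ) + ((L - m : ℕ) : ℤ) / 2) (2 * M : ℕ) else 0) =
      if 2 ∣ (L : ℤ) - m then q ^ (m ^ 2) * qBinom (q ^ 2) (3 * M) m *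
        qBinom (q ^ 6) (2 * M + (L - m) / 2) (2 * M) else 0 := by
    intro m hm
    rw [Nat.cast_sub (by rw [mem_range] at hm; omega), gaussWeight, ← pow_mul]
    push_cast
    rw [mul_ite, mul_zero]
  rw [sum_congr rfl h, baseSum,
    sum_subset (range_subset_range.2 (le_max_left (3 * M + 1) (L + 1))),
    sum_subset (range_subset_range.2 (le_max_right (3 * M + 1) (L + 1)))]
  · intro m _ hm
    rw [mem_range] at hm
    rw [qBinom_of_not (q ^ 6) (by omega), mul_zero, ite_self]
  · intro m _ hm
    rw [mem_range] at hm
    rw [qBinom_of_not (q ^ 2) (by omega), mul_zero, zero_mul, ite_self]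

theorem sum_refinedTrinomial_term_eq (hq0 : q ≠ 0) {L M n : ℕ} (hn : n ≤ L) :
    coeff (L - n) (saalschuetzSeries (q ^ 3) ((q ^ 2)⁻¹) (q ^ 2) M M) =
      ∑ j ∈ Icc (-(L : ℤ)) L, q ^ (3 * j ^ 2 + 2 * j) * if (L : ℤ) - j ≡ n [ZMOD 2] then
        qBinom ((q ^ 3) ^ 2) (M + j + (L - j - n) / 2) (M + j)
          * qBinom ((q ^ 3) ^ 2) (M - j + (L + j - n) / 2) (M - j) else 0 := by
  simp only [saalschuetzSeries, diagSeries, coeff_mk]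
  refine sum_of_injOn (fun p : ℕ × ℕ => (p.2 : ℤ) - p.1) ?_ ?_ ?_ ?_
  · rintro ⟨c, d⟩ h ⟨c', d'⟩ h' he
    simp only [SetLike.mem_coe, HasAntidiagonal.mem_antidiagonal] at h h' he
    ext <;> simp only <;> omega
  · rintro ⟨c, d⟩ h
    simp only [SetLike.mem_coe, HasAntidiagonal.mem_antidiagonal, coe_Icc, Set.mem_Icc] at h ⊢
    omega
  · intro j _ hj
    convert mul_zero _
    split_ifs with hmod
    swap
    · rfl
    unfold Int.ModEq at hmod
    by_contra hne
    apply hj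
    have h1 := left_ne_zero_of_mul hne
    have h2 := right_ne_zero_of_mul hne
    have h1' : 0 ≤ ((L : ℤ) - j - n) / 2 := by
      by_contra h; exact h1 (qBinom_of_not _ (by omega))
    have h2' : 0 ≤ ((L : ℤ) + j - n) / 2 := by
      by_contra h; exact h2 (qBinom_of_not _ (by omega))
    refine ⟨((((L : ℤ) - j - n) / 2).toNat, (((L : ℤ) + j - n) / 2).toNat), ?_, ?_⟩
    · simp only [SetLike.mem_coe, HasAntidiagonal.mem_antidiagonal]
      omega
    · simp only
      omega
  · rintro ⟨c, d⟩ h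
    rw [HasAntidiagonal.mem_antidiagonal] at h
    simp only at h ⊢
    rw [if_pos (by unfold Int.ModEq; omega), show ((L : ℤ) - (d - c) - n) / 2 = c by omega,
      show ((L : ℤ) + (d - c) - n) / 2 = d by omega, saalschuetzTerm,
      qBinom_symm _ ((M : ℤ) + (d - c) + c), qBinom_symm _ ((M : ℤ) - (d - c) + d)]
    rw [show (M : ℤ) + (d - c) + c = M + d by ring, show (M : ℤ) - (d - c) + d = M + c by ring,
      show (M : ℤ) + d - (M + (d - c)) = c by ring, show (M : ℤ) + c - (M - (d - c)) = d by ring]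
    have e : q ^ (3 * ((d : ℤ) - c) ^ 2 + 2 * (d - c)) =
        (q ^ 2)⁻¹ ^ (c : ℤ) * (q ^ 2) ^ (d : ℤ) * (q ^ 3) ^ (((c : ℤ) - d) ^ 2) := by
      rw [← zpow_neg_one, ← zpow_natCast q 2, ← zpow_natCast q 3, ← zpow_mul, ← zpow_mul,
        ← zpow_mul, ← zpow_mul, ← zpow_add₀ hq0, ← zpow_add₀ hq0]
      congr 1; push_cast; ring
    rw [e]
    ring

theorem baseSum_eq (hq0 : q ≠ 0) (hq : ∀ k : ℕ, 0 < k → q ^ k ≠ 1) (L M : ℕ) :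
    baseSum q L M = ∑ j ∈ Icc (-(L : ℤ)) L,
      q ^ (3 * j ^ 2 + 2 * j) * refinedTrinomial (q ^ 3) L M j j := by
  rw [baseSum_eq_coeff, gaussWeight_mul_evenSeries hq0 hq, coeff_mul,
    Finset.Nat.sum_antidiagonal_eq_sum_range_succ_mk]
  have h : ∀ n ∈ range (L + 1), coeff n (PowerSeries.mk (gaussWeight (q ^ 3) M)) *
      coeff (L - n) (saalschuetzSeries (q ^ 3) ((q ^ 2)⁻¹) (q ^ 2) M M) =
      gaussWeight (q ^ 3) M n * ∑ j ∈ Icc (-(L : ℤ)) L, q ^ (3 * j ^ 2 + 2 * j) *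
        if (L : ℤ) - j ≡ n [ZMOD 2] then
          qBinom ((q ^ 3) ^ 2) (M + j + (L - j - n) / 2) (M + j)
            * qBinom ((q ^ 3) ^ 2) (M - j + (L + j - n) / 2) (M - j) else 0 := fun n hn => by
    rw [coeff_mk, sum_refinedTrinomial_term_eq hq0 (by rw [mem_range] at hn; omega)]
  rw [sum_congr rfl h, sum_subset (range_subset_range.2 (le_max_right (M + 1) (L + 1)))]
  · simp only [refinedTrinomial, mul_sum]
    rw [sum_comm]
    refine sum_congr rfl fun j _ => ?_
    rw [Int.toNat_natCast]
    rw [eq_comm, sum_subset (range_subset_range.2 (le_max_left (M + 1) (L + 1)))]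
    · refine sum_congr rfl fun n _ => ?_
      rw [gaussWeight]
      split_ifs
      · ring
      · ring
    · intro n _ hn
      rw [mem_range] at hn
      rw [qBinom_of_not _ (b := n) (by omega)]
      simp
  · intro n _ hn
    rw [mem_range] at hn
    convert mul_zero _
    refine sum_eq_zero fun j _ => ?_
    convert mul_zero _
    split_ifs with hmod
    swap
    · rfl
    unfold Int.ModEq at hmod
    by_cases h1 : 0 ≤ ((L : ℤ) - j - n) / 2
    · rw [qBinom_of_not _ (b := (M : ℤ) - j) (by omega), mul_zero]
    · rw [qBinom_of_not _ (b := (M : ℤ) + j) (by omega), zero_mul]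

end Base

/-- The multiple sum of the hierarchy, defined by peeling off the outermost summation. -/
def hierarchySum {K : Type*} [Field K] (q : K) : ℕ → ℕ → ℕ → K
  | 0, L, M => baseSum q L M
  | ν + 1, L, M => ∑ i ∈ range (M + 1), if i ≤ L then
      q ^ (3 * i ^ 2) * qBinom (q ^ 6) ((L : ℤ) + M - i) L * hierarchySum q ν (L - i) i else 0

section Trinomial

variable {K : Type*} [Field K] {s q : K}

theorem refinedTrinomial_neg (s : K) (L M a b : ℤ) :
    refinedTrinomial s L M (-a) (-b) = refinedTrinomial s L M a b := by
  refine sum_congr rfl fun n _ => ?_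
  have h : (L - -a ≡ (n : ℤ) [ZMOD 2]) ↔ (L - a ≡ (n : ℤ) [ZMOD 2]) := by
    unfold Int.ModEq; omega
  simp only [h]
  rw [← sub_eq_add_neg, ← sub_eq_add_neg, sub_neg_eq_add, sub_neg_eq_add]
  split_ifs
  · ring
  · rfl

theorem refinedTrinomial_of_lt (s : K) {L M a b : ℤ} (h : L < |a|) :
    refinedTrinomial s L M a b = 0 := by
  refine sum_eq_zero fun n _ => ?_
  split_ifs
  swap
  · rfl
  rcases lt_abs.1 h with h | h
  · rw [qBinom_of_not _ (b := M + b) (by omega)]; simp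
  · rw [qBinom_of_not _ (b := M - b) (by omega)]; simp

theorem refinedTrinomial_eq_polyTrinomial (hq : ∀ k : ℕ, 0 < k → (s ^ 2) ^ k ≠ 1) (L : ℤ) (M : ℕ)
    {a : ℤ} (ha : 0 ≤ a) (b : ℤ) :
    refinedTrinomial s L M a b = polyTrinomial s b M (L - a) a := by
  rw [refinedTrinomial, polyTrinomial, Int.toNat_natCast]
  refine sum_congr rfl fun n _ => ?_
  rw [trinomialFactor, gaussWeight]
  by_cases h : 2 ∣ L - a - n
  swap
  · rw [if_neg h, if_neg (by unfold Int.ModEq; omega), mul_zero]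
  rw [if_pos h, if_pos (by unfold Int.ModEq; omega)]
  by_cases hc : 0 ≤ (L - a - n) / 2
  · rw [qBinom_add hq (M - b), if_pos (by omega),
      show (L + a - n) / 2 = (L - a - n) / 2 + a by omega]
    ring
  · rw [qBinom_of_not _ (b := (M : ℤ) + b) (by omega)]
    simp

theorem sum_refinedTrinomial (hs : s ≠ 0) (hq : ∀ k : ℕ, 0 < k → (s ^ 2) ^ k ≠ 1) (L M c : ℕ)
    (j : ℤ) :
    (∑ i ∈ range (M + 1), if i ≤ L then s ^ (i ^ 2) * qBinom (s ^ 2) ((L : ℤ) + M - i) L *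
      refinedTrinomial s ((L - i : ℕ) : ℤ) i (c * j) j else 0) =
    s ^ (j ^ 2) * refinedTrinomial s L M ((c + 1) * j) j := by
  wlog hj : 0 ≤ j generalizing j
  · have := this (-j) (by omega)
    simpa only [mul_neg, refinedTrinomial_neg, neg_sq] using this
  lift j to ℕ using hj
  have hcj : 0 ≤ (c : ℤ) * j := by positivity
  have key := trinomialTransform_eq hs hq j M (L - c * j) (c * j)
  rw [refinedTrinomial_eq_polyTrinomial hq L M (a := (c + 1) * j) (by positivity),
    show (L : ℤ) - (c + 1) * j = L - c * j - j by ring, show ((c : ℤ) + 1) * j = c * j + j by ring,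
    ← Nat.cast_pow, zpow_natCast, ← key, trinomialTransform]
  refine sum_congr rfl fun i hi => ?_
  rw [mem_range] at hi
  split_ifs with h
  · rw [refinedTrinomial_eq_polyTrinomial hq _ _ hcj, qBinom_eq_gaussH hq (by omega),
      Nat.cast_sub h]
    rw [show (L : ℤ) - i - c * j = L - c * j - i by ring,
      show (L : ℤ) - c * j + c * j = L by ring, show (L : ℤ) + M - i - L = M - i by ring]
  · rw [polyTrinomial_of_neg _ _ _ (by omega), mul_zero]

theorem hierarchySum_eq (hq0 : q ≠ 0) (hq : ∀ k : ℕ, 0 < k → q ^ k ≠ 1) (ν L M : ℕ) :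
    hierarchySum q ν L M = ∑ j ∈ Icc (-(L : ℤ)) L,
      q ^ (3 * ((ν : ℤ) + 1) * j ^ 2 + 2 * j) *
        refinedTrinomial (q ^ 3) L M (((ν : ℤ) + 1) * j) j := by
  have h6 : ∀ k : ℕ, 0 < k → ((q ^ 3) ^ 2) ^ k ≠ 1 := fun k hk => by
    rw [← pow_mul, ← pow_mul]; exact hq _ (by omega)
  induction ν generalizing L M with
  | zero =>
    rw [hierarchySum, baseSum_eq hq0 hq]
    simp
  | succ ν ih =>
    rw [hierarchySum]
    have h1 : ∀ i ∈ range (M + 1), (if i ≤ L then q ^ (3 * i ^ 2) *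
        qBinom (q ^ 6) ((L : ℤ) + M - i) L * hierarchySum q ν (L - i) i else 0) =
        ∑ j ∈ Icc (-(L : ℤ)) L, q ^ (3 * ((ν : ℤ) + 1) * j ^ 2 + 2 * j) *
          if i ≤ L then (q ^ 3) ^ (i ^ 2) * qBinom ((q ^ 3) ^ 2) ((L : ℤ) + M - i) L *
            refinedTrinomial (q ^ 3) ((L - i : ℕ) : ℤ) i (((ν + 1 : ℕ) : ℤ) * j) j else 0 := by
      intro i _
      split_ifs with hi
      swap
      · simp
      rw [ih, ← pow_mul, ← pow_mul, mul_sum]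
      have hsub : Icc (-((L - i : ℕ) : ℤ)) ((L - i : ℕ) : ℤ) ⊆ Icc (-(L : ℤ)) L :=
        Icc_subset_Icc (by omega) (by omega)
      rw [sum_subset hsub]
      · refine sum_congr rfl fun j _ => ?_
        push_cast
        ring
      · intro j _ hj
        rw [refinedTrinomial_of_lt, mul_zero, mul_zero]
        rw [mem_Icc, ← abs_le, not_le] at hj
        rw [abs_mul, abs_of_nonneg (by positivity : (0 : ℤ) ≤ (ν : ℤ) + 1)]
        nlinarith [abs_nonneg j]
    rw [sum_congr rfl h1, sum_comm]
    refine sum_congr rfl fun j _ => ?_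
    rw [← mul_sum, sum_refinedTrinomial (pow_ne_zero 3 hq0) h6, ← mul_assoc]
    congr 1
    · rw [← zpow_natCast q 3, ← zpow_mul, ← zpow_add₀ hq0]
      congr 1; push_cast; ring

end Trinomial

section Hierarchy

variable {K : Type*} [Field K]

@[to_additive]
theorem prod_Icc_succ_bot {R : Type*} [CommMonoid R] (f : ℕ → R) (n : ℕ) :
    ∏ k ∈ Icc 1 (n + 1), f k = f 1 * ∏ k ∈ Icc 1 n, f (k + 1) := by
  induction n with
  | zero => simp
  | succ n ih =>
    rw [prod_Icc_succ_top (by omega), ih, prod_Icc_succ_top (by omega), mul_assoc]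

theorem entry_eq {ν : ℕ} (n : Fin ν → ℕ) (i : Fin ν) : entry n (i + 1) = n i := by
  rw [entry, dif_pos (by omega)]
  congr

theorem entry_cons_one {ν : ℕ} (a : ℕ) (n : Fin ν → ℕ) :
    entry (Fin.cons a n : Fin (ν + 1) → ℕ) 1 = a := by
  rw [entry, dif_pos (by omega)]
  rfl

theorem entry_cons_succ {ν : ℕ} (a : ℕ) (n : Fin ν → ℕ) {k : ℕ} (hk : 1 ≤ k) :
    entry (Fin.cons a n : Fin (ν + 1) → ℕ) (k + 1) = entry n k := by
  obtain ⟨k, rfl⟩ := Nat.exists_eq_add_of_le' hk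
  unfold entry
  by_cases h : k + 1 ≤ ν
  · rw [dif_pos (by omega), dif_pos (by omega)]
    exact Fin.cons_succ (α := fun _ => ℕ) a n ⟨k, by omega⟩
  · rw [dif_neg (by omega), dif_neg (by omega)]

theorem tailSum_cons_succ {ν : ℕ} (a : ℕ) (n : Fin ν → ℕ) {k : ℕ} (hk : 1 ≤ k) :
    tailSum (Fin.cons a n : Fin (ν + 1) → ℕ) (k + 1) = tailSum n k := by
  unfold tailSum
  rw [← map_add_right_Icc, sum_map]
  refine sum_congr rfl fun i hi => ?_
  rw [mem_Icc] at hi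
  exact entry_cons_succ a n (by omega)

theorem tailSum_cons_one {ν : ℕ} (a : ℕ) (n : Fin ν → ℕ) :
    tailSum (Fin.cons a n : Fin (ν + 1) → ℕ) 1 = a + tailSum n 1 := by
  rw [tailSum, sum_Icc_succ_bot, entry_cons_one]
  congr 1
  refine sum_congr rfl fun i hi => ?_
  rw [mem_Icc] at hi
  exact entry_cons_succ a n (by omega)

theorem sum_tailSum_cons {R : Type*} [AddCommMonoid R] (f : ℕ → R) {ν : ℕ} (a : ℕ)
    (n : Fin ν → ℕ) (j : ℕ) :
    ∑ k ∈ Icc 1 (j + 1), f (tailSum (Fin.cons a n : Fin (ν + 1) → ℕ) k) =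
      f (a + tailSum n 1) + ∑ k ∈ Icc 1 j, f (tailSum n k) := by
  rw [sum_Icc_succ_bot, tailSum_cons_one]
  congr 1
  refine sum_congr rfl fun i hi => ?_
  rw [mem_Icc] at hi
  rw [tailSum_cons_succ a n (by omega)]

theorem hierarchyTerm_cons (q : K) {ν : ℕ} (hν : 0 < ν) (L M m a : ℕ) (n : Fin ν → ℕ) :
    hierarchyTerm q L M m (Fin.cons a n : Fin (ν + 1) → ℕ) =
      if a + tailSum n 1 ≤ L then q ^ (3 * (a + tailSum n 1) ^ 2) *
        qBinom (q ^ 6) ((L : ℤ) + M - (a + tailSum n 1 : ℕ)) L *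
        hierarchyTerm q (L - (a + tailSum n 1)) (a + tailSum n 1) m n else 0 := by
  obtain ⟨μ, rfl⟩ : ∃ μ, ν = μ + 1 := ⟨ν - 1, by omega⟩
  unfold hierarchyTerm
  have s1 := sum_tailSum_cons (fun x => x) a n (μ + 1)
  have s2 := sum_tailSum_cons (fun x => x ^ 2) a n (μ + 1)
  have s3 : ∀ j, _ := sum_tailSum_cons (fun x => (x : ℤ)) a n
  beta_reduce at s1 s2 s3
  rw [s1, s2, s3, tailSum_cons_one, entry_cons_succ a n (by omega), Nat.add_sub_cancel,
    Nat.add_sub_cancel, prod_Icc_succ_bot, entry_cons_one]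
  have s4 : ∏ k ∈ Icc 1 μ, qBinom (q ^ 6) ((L : ℤ) -
        ∑ l ∈ Icc 1 (k + 1), (tailSum (Fin.cons a n : Fin (μ + 1 + 1) → ℕ) l : ℤ) +
        entry (Fin.cons a n : Fin (μ + 1 + 1) → ℕ) (k + 1))
        (entry (Fin.cons a n : Fin (μ + 1 + 1) → ℕ) (k + 1)) =
      ∏ k ∈ Icc 1 μ, qBinom (q ^ 6) ((L : ℤ) - (a + tailSum n 1 : ℕ) -
        ∑ l ∈ Icc 1 k, (tailSum n l : ℤ) + entry n k) (entry n k) := by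
    refine prod_congr rfl fun k hk => ?_
    rw [mem_Icc] at hk
    rw [s3, entry_cons_succ a n (by omega), sub_sub]
  rw [s4]
  simp only [Icc_self, sum_singleton, tailSum_cons_one]
  set N := tailSum n 1
  set S := ∑ k ∈ Icc 1 (μ + 1), tailSum n k
  by_cases hL : a + N ≤ L
  · have hmod : (L + m ≡ a + N + S [MOD 2]) ↔ (L - (a + N) + m ≡ S [MOD 2]) := by
      unfold Nat.ModEq; omega
    rw [if_pos hL, mul_ite, mul_zero, Nat.cast_sub hL, sub_add_cancel,
      qBinom_symm _ ((L : ℤ) - N), show (L : ℤ) - N - (L - (a + N : ℕ)) = a by push_cast; ring,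
      show (L : ℤ) - (a + N : ℕ) + a = L - N by push_cast; ring]
    simp only [hmod]
    split_ifs
    · rw [show (L : ℤ) - m - ((a + N : ℕ) + ∑ k ∈ Icc 1 (μ + 1), (tailSum n k : ℤ)) =
        L - (a + N : ℕ) - m - ∑ k ∈ Icc 1 (μ + 1), (tailSum n k : ℤ) by ring]
      ring
    · rfl
  · rw [if_neg hL, qBinom_of_not (q ^ 6) (a := (L : ℤ) - (a + N : ℕ) + a) (by omega)]
    simp

theorem hierarchyTerm_one (q : K) (L M m a : ℕ) (n : Fin 0 → ℕ) :
    hierarchyTerm q L M m (Fin.cons a n : Fin 1 → ℕ) =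
      if a ≤ L then q ^ (3 * a ^ 2) * qBinom (q ^ 6) ((L : ℤ) + M - a) L *
        (if 2 ∣ ((L - a : ℕ) : ℤ) - m then q ^ (m ^ 2) * qBinom (q ^ 2) (3 * a) m *
          qBinom (q ^ 6) (2 * a + (((L - a : ℕ) : ℤ) - m) / 2) (2 * a) else 0) else 0 := by
  have h1 : tailSum (Fin.cons a n : Fin 1 → ℕ) 1 = a := by
    rw [tailSum_cons_one]; simp [tailSum]
  have h2 : entry (Fin.cons a n : Fin 1 → ℕ) 1 = a := entry_cons_one a n
  simp only [hierarchyTerm, Icc_self, sum_singleton, h1, h2]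
  by_cases hL : a ≤ L
  · have hmod : (L + m ≡ a [MOD 2]) ↔ 2 ∣ ((L - a : ℕ) : ℤ) - m := by
      unfold Nat.ModEq; omega
    rw [if_pos hL]
    simp only [hmod]
    rw [mul_ite, mul_zero, show (L : ℤ) - m - a = ((L - a : ℕ) : ℤ) - m by omega]
    split_ifs
    · simp; ring
    · rfl
  · rw [if_neg hL]
    split_ifs with h
    · unfold Nat.ModEq at h
      rw [qBinom_of_not (q ^ 6) (a := 2 * (a : ℤ) + _) (by omega)]
      simp
    · rfl

theorem hierarchyTerm_support (q : K) {ν : ℕ} (hν : 0 < ν) {L M m : ℕ} {n : Fin ν → ℕ}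
    (h : hierarchyTerm q L M m n ≠ 0) :
    m ≤ 3 * M ∧ tailSum n 1 ≤ M ∧ ∀ i, n i ≤ M := by
  unfold hierarchyTerm at h
  split_ifs at h with hmod
  swap
  · exact absurd rfl h
  have h1 := left_ne_zero_of_mul (left_ne_zero_of_mul (left_ne_zero_of_mul h))
  have h2 := right_ne_zero_of_mul h1
  have h3 := right_ne_zero_of_mul (left_ne_zero_of_mul (left_ne_zero_of_mul h))
  have hN : tailSum n 1 ≤ M := by
    by_contra hc; exact h2 (qBinom_of_not _ (by omega))
  have hm : m ≤ 3 * entry n ν := by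
    by_contra hc; exact h3 (qBinom_of_not _ (by omega))
  have he : ∀ k, 1 ≤ k → k ≤ ν → entry n k ≤ M := fun k hk hk' =>
    (single_le_sum (fun i _ => Nat.zero_le (entry n i)) (mem_Icc.2 ⟨hk, hk'⟩)).trans hN
  refine ⟨?_, hN, fun i => ?_⟩
  · have := he ν hν le_rfl
    omega
  · rw [← entry_eq n i]
    exact he _ (by omega) (by omega)

theorem sum_piFinset_cons {R : Type*} [AddCommMonoid R] {ν : ℕ} (s : Finset ℕ)
    (f : (Fin (ν + 1) → ℕ) → R) :
    ∑ n ∈ Fintype.piFinset (fun _ : Fin (ν + 1) => s), f n =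
      ∑ n ∈ Fintype.piFinset (fun _ : Fin ν => s), ∑ a ∈ s, f (Fin.cons a n : Fin (ν + 1) → ℕ) := by
  rw [← sum_product' (f := fun n a => f (Fin.cons a n : Fin (ν + 1) → ℕ))]
  refine sum_nbij' (fun n => (Fin.tail n, n 0)) (fun p => (Fin.cons p.2 p.1 : Fin (ν + 1) → ℕ))
    ?_ ?_ ?_ ?_ ?_
  · intro n hn
    rw [Fintype.mem_piFinset] at hn
    exact mem_product.2 ⟨Fintype.mem_piFinset.2 fun i => hn i.succ, hn 0⟩
  · rintro ⟨n, a⟩ hp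
    rw [mem_product, Fintype.mem_piFinset] at hp
    rw [Fintype.mem_piFinset]
    intro i
    cases i using Fin.cases with
    | zero => exact hp.2
    | succ i => exact hp.1 i
  · intro n _
    exact Fin.cons_self_tail n
  · rintro ⟨n, a⟩ _
    rfl
  · intro n _
    simp only
    rw [Fin.cons_self_tail]

theorem sum_shift_eq {R : Type*} [AddCommMonoid R] (f : ℕ → R) {t M b : ℕ} (hb : M ≤ b)
    (h1 : ∀ i, M < i → f i = 0) (h2 : ∀ i, i < t → f i = 0) :
    ∑ a ∈ range (b + 1), f (a + t) = ∑ i ∈ range (M + 1), f i := by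
  have e1 : ∑ a ∈ range (b + 1), f (a + t) = ∑ i ∈ range (b + 1 + t), f i := by
    rw [add_comm (b + 1) t, sum_range_add f t, sum_eq_zero (s := range t)
      (fun i hi => h2 i (mem_range.1 hi)), zero_add]
    simp only [add_comm t]
  rw [e1]
  symm
  refine sum_subset (range_subset_range.2 (by omega)) fun i _ hi => h1 i ?_
  rw [mem_range] at hi
  omega

theorem sum_hierarchyTerm (q : K) (ν : ℕ) (L M b : ℕ) (hb : M ≤ b) :
    ∑ m ∈ range (3 * b + 1), ∑ n ∈ Fintype.piFinset (fun _ : Fin (ν + 1) => range (b + 1)),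
      hierarchyTerm q L M m n = hierarchySum q (ν + 1) L M := by
  have hz : ∀ i : ℕ, M < i → qBinom (q ^ 6) ((L : ℤ) + M - i) L = 0 := fun i hi =>
    qBinom_of_not _ (by omega)
  induction ν generalizing L M with
  | zero =>
    simp only [sum_piFinset_cons, hierarchyTerm_one]
    simp only [Fintype.piFinset_of_isEmpty, univ_unique, sum_singleton]
    rw [sum_comm, hierarchySum, eq_comm,
      sum_subset (range_subset_range.2 (show M + 1 ≤ b + 1 by omega))]
    · refine sum_congr rfl fun i hi => ?_
      rw [mem_range] at hi
      split_ifs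
      swap
      · simp
      rw [← mul_sum, hierarchySum, baseSum]
      congr 1
      refine sum_subset (range_subset_range.2 (by omega)) fun m _ hm => ?_
      rw [mem_range] at hm
      rw [qBinom_of_not (q ^ 2) (by omega), mul_zero, zero_mul, ite_self]
    · intro i _ hi
      rw [mem_range] at hi
      rw [hz i (by omega)]
      simp
  | succ ν ih =>
    simp only [sum_piFinset_cons (ν := ν + 1), hierarchyTerm_cons q (Nat.succ_pos ν)]
    have h1 : ∀ (m : ℕ) (n : Fin (ν + 1) → ℕ), ∑ a ∈ range (b + 1),
        (if a + tailSum n 1 ≤ L then q ^ (3 * (a + tailSum n 1) ^ 2) *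
          qBinom (q ^ 6) ((L : ℤ) + M - (a + tailSum n 1 : ℕ)) L *
          hierarchyTerm q (L - (a + tailSum n 1)) (a + tailSum n 1) m n else 0) =
        ∑ i ∈ range (M + 1), if i ≤ L then q ^ (3 * i ^ 2) *
          qBinom (q ^ 6) ((L : ℤ) + M - i) L * hierarchyTerm q (L - i) i m n else 0 := by
      intro m n
      refine sum_shift_eq (fun i => if i ≤ L then q ^ (3 * i ^ 2) *
          qBinom (q ^ 6) ((L : ℤ) + M - i) L * hierarchyTerm q (L - i) i m n else 0) hb ?_ ?_
      · intro i hi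
        simp [hz i hi]
      · intro i hi
        have : hierarchyTerm q (L - i) i m n = 0 := by
          by_contra hne
          have := (hierarchyTerm_support q (Nat.succ_pos ν) hne).2.1
          omega
        simp [this]
    simp only [h1]
    rw [sum_congr rfl fun m _ => sum_comm, sum_comm, hierarchySum]
    refine sum_congr rfl fun i hi => ?_
    rw [mem_range] at hi
    split_ifs
    swap
    · simp
    simp only [← mul_sum]
    rw [ih (L - i) i (by omega)]
    intro k hk
    exact qBinom_of_not _ (by omega)

theorem qBinom_zero_eq_one {a b : ℤ} (hb : 0 ≤ b) (hab : 0 ≤ a - b) : qBinom (0 : K) a b = 1 := by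
  have h : ∀ n, qPoch (0 : K) 0 n = 1 := fun n => by simp [qPoch]
  rw [qBinom, if_pos ⟨hb, hab⟩, h, h, h]
  simp

theorem hierarchySum_zero_base (ν L M : ℕ) :
    hierarchySum (0 : K) ν L M = if 2 ∣ (L : ℤ) then 1 else 0 := by
  induction ν generalizing L M with
  | zero =>
    rw [hierarchySum, baseSum, sum_eq_single 0]
    · by_cases h : 2 ∣ (L : ℤ)
      · rw [if_pos (by simpa using h), if_pos h]
        simp only [ne_eq, OfNat.ofNat_ne_zero, not_false_eq_true, zero_pow, pow_zero, one_mul]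
        rw [qBinom_zero_eq_one (by simp) (by simp), qBinom_zero_eq_one (by simp) (by simp; omega)]
        simp
      · rw [if_neg (by simpa using h), if_neg h]
    · intro m _ hm
      simp [hm]
    · simp
  | succ ν ih =>
    rw [hierarchySum, sum_eq_single 0]
    · simp [ih, qBinom_zero_eq_one]
    · intro m _ hm
      simp [hm]
    · simp

theorem refinedTrinomial_zero_base (L M : ℕ) :
    refinedTrinomial (0 : K) L M 0 0 = if 2 ∣ (L : ℤ) then 1 else 0 := by
  rw [refinedTrinomial, sum_eq_single 0]
  · by_cases h : 2 ∣ (L : ℤ)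
    · rw [if_pos (by unfold Int.ModEq; omega), if_pos h]
      simp only [ne_eq, OfNat.ofNat_ne_zero, not_false_eq_true, zero_pow, pow_zero, one_mul]
      rw [qBinom_zero_eq_one (by simp) (by simp), qBinom_zero_eq_one (by simp) (by simp; omega),
        qBinom_zero_eq_one (by simp) (by simp; omega)]
      simp
    · rw [if_neg (by unfold Int.ModEq; omega), if_neg h]
  · intro n _ hn
    simp [hn]
  · simp

theorem hierarchySum_eq_sum {q : K} (hq : ∀ k : ℕ, 0 < k → q ^ k ≠ 1) (ν L M : ℕ) :
    hierarchySum q ν L M = ∑ j ∈ Icc (-(L : ℤ)) L,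
      q ^ (3 * ((ν : ℤ) + 1) * j ^ 2 + 2 * j) *
        refinedTrinomial (q ^ 3) L M (((ν : ℤ) + 1) * j) j := by
  rcases eq_or_ne q 0 with rfl | hq0
  · rw [hierarchySum_zero_base, sum_eq_single 0]
    · simp [refinedTrinomial_zero_base]
    · intro j _ hj
      have h : 3 * ((ν : ℤ) + 1) * j ^ 2 + 2 * j ≠ 0 := by
        have h1 : 1 ≤ j ^ 2 := by have := sq_pos_of_ne_zero hj; omega
        nlinarith [mul_nonneg (Int.natCast_nonneg ν) (sq_nonneg j), sq_nonneg (j + 1)]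
      rw [zero_zpow _ h, zero_mul]
    · simp
  · exact hierarchySum_eq hq0 hq ν L M

end Hierarchy

theorem mainTheorem3 {K : Type*} [Field K] (q : K) (hq : ∀ k : ℕ, 0 < k → q ^ k ≠ 1)
    (ν : ℕ) (hν : 0 < ν) (L M : ℕ) :
    {p : ℕ × (Fin ν → ℕ) | hierarchyTerm q L M p.1 p.2 ≠ 0}.Finite ∧
    {j : ℤ | q ^ (3 * ((ν : ℤ) + 1) * j ^ 2 + 2 * j)
        * refinedTrinomial (q ^ 3) L M (((ν : ℤ) + 1) * j) j ≠ 0}.Finite ∧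
    ∑ᶠ p : ℕ × (Fin ν → ℕ), hierarchyTerm q L M p.1 p.2
      = ∑ᶠ j : ℤ, q ^ (3 * ((ν : ℤ) + 1) * j ^ 2 + 2 * j)
          * refinedTrinomial (q ^ 3) L M (((ν : ℤ) + 1) * j) j := by
  have h1 : Function.support (fun p : ℕ × (Fin ν → ℕ) => hierarchyTerm q L M p.1 p.2) ⊆
      ↑(range (3 * M + 1) ×ˢ Fintype.piFinset fun _ : Fin ν => range (M + 1)) := by
    intro p hp
    obtain ⟨hm, -, hn⟩ := hierarchyTerm_support q hν hp
    rw [SetLike.mem_coe, mem_product, Fintype.mem_piFinset, mem_range]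
    exact ⟨by omega, fun i => mem_range.2 (by have := hn i; omega)⟩
  have h2 : Function.support (fun j : ℤ => q ^ (3 * ((ν : ℤ) + 1) * j ^ 2 + 2 * j)
      * refinedTrinomial (q ^ 3) L M (((ν : ℤ) + 1) * j) j) ⊆ ↑(Icc (-(L : ℤ)) L) := by
    intro j hj
    rw [SetLike.mem_coe, mem_Icc, ← abs_le]
    by_contra hc
    apply hj
    simp only
    rw [refinedTrinomial_of_lt, mul_zero]
    rw [abs_mul, abs_of_nonneg (by positivity : (0 : ℤ) ≤ (ν : ℤ) + 1)]
    nlinarith [abs_nonneg j]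
  refine ⟨(finite_toSet _).subset h1, (finite_toSet _).subset h2, ?_⟩
  rw [finsum_eq_sum_of_support_subset _ h1, finsum_eq_sum_of_support_subset _ h2,
    ← hierarchySum_eq_sum hq, sum_product]
  obtain ⟨μ, rfl⟩ : ∃ μ, ν = μ + 1 := ⟨ν - 1, by omega⟩
  exact sum_hierarchyTerm q μ L M M le_rfl
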